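/- **Proposition.** Let $(\mathcal M,g)$ be a smooth finite-dimensional semi-Riemannian manifold of arbitrary signature, with Ricci tensor $\mathrm{Ric}$. Let $\mathcal H$ be a smooth manifold with $\dim\mathcal H=\dim\mathcal M-1$, and let $\Phi:\mathcal H\hookrightarrow\mathcal M$ be a smooth embedding that is null, i.e. $\gamma:=\Phi^\star g$ is degenerate at every point of $\mathcal H$. Let $\xi$ be a rigging of $\Phi(\mathcal H)$, extended arbitrarily off $\Phi(\mathcal H)$: a smooth vector field on a neighbourhood of $\Phi(\mathcal H)$ that is transversal to $\Phi(\mathcal H)$ at every point of $\Phi(\mathcal H)$. Put $\ell:=\Phi^\star(g(\xi,\cdot))$ and $\ell^{(2)}:=\Phi^\star(g(\xi,\xi))$. On $T_p\mathcal H\times\mathbb R$ consider the symmetric bilinear form $$\mathcal A\big((W,a),(V,b)\big)=\gamma(W,V)+a\,\ell(V)+b\,\ell(W)+ab\,\ell^{(2)},$$ which is non-degenerate, and let the vector field $n$ and the symmetric $(2,0)$-tensor field $P$ on $\mathcal H$ be given by the components of its inverse, $\mathcal A^\sharp\big((\alpha,a),(\beta,b)\big)=P(\alpha,\beta)+a\,n(\beta)+b\,n(\alpha)+ab\,n^{(2)}$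 (here $n^{(2)}=0$). Let $\mathcal L_\xi^{(k)}$ denote the $k$-th iterated Lie derivative along $\xi$ ($\mathcal L^{(0)}_\xi=\mathrm{id}$), and for $k\ge 0$ put $$\mathcal K^{(k)}:=\mathcal L_\xi^{(k)}g,\qquad \mathcal R^{(k+1)}:=\Phi^\star\big(\mathcal L_\xi^{(k)}\mathrm{Ric}\big).$$ Let $\lambda\in\mathbb R$ and let $m\ge 1$ be an integer, and suppose that for every $i=1,\dots,m$ $$\mathcal L_\xi^{(i-1)}\mathrm{Ric}=\lambda\,\mathcal L_\xi^{(i-1)}g\qquad\text{at every point of }\Phi(\mathcal H)$$ (as an equality of all components of the ambient tensors). Then, on $\mathcal H$, $$n^a\,\mathcal R^{(m+1)}_{ab}=\lambda\, n^a\,(\Phi^\star\mathcal K^{(m)})_{ab}\qquad\text{and}\qquad P^{ab}\,\mathcal R^{(m+1)}_{ab}=\lambda\, P^{ab}\,(\Phi^\star\mathcal K^{(m)})_{ab}.$$ -/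

import Mathlib

open scoped Manifold ContDiff

set_option maxSynthPendingDepth 3

noncomputable section

namespace NullHypersurface

open Set Topology VectorField

/-! ## Coordinate expressions on a vector space -/

section Coordinates

variable {E : Type*} [NormedAddCommGroup E] [NormedSpace ℝ E]

/-- Christoffel symbols of the first kind of a field of bilinear forms `g` on `E`,
see `christoffelFirst_apply` for the formula. -/
def christoffelFirst (g : E → E →L[ℝ] E →L[ℝ] ℝ) (y : E) : E →L[ℝ] E →L[ℝ] E →L[ℝ] ℝ :=
  let D : E →L[ℝ] E →L[ℝ] E →L[ℝ] ℝ := fderiv ℝ g y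
  let D' : E →L[ℝ] E →L[ℝ] E →L[ℝ] ℝ :=
    (ContinuousLinearMap.flipₗᵢ ℝ E E ℝ).toContinuousLinearEquiv.toContinuousLinearMap.comp D.flip
  (1 / 2 : ℝ) • (D + D.flip - D')

theorem christoffelFirst_apply (g : E → E →L[ℝ] E →L[ℝ] ℝ) (y u v w : E) :
    christoffelFirst g y u v w =
      (1 / 2) * (fderiv ℝ g y u v w + fderiv ℝ g y v u w - fderiv ℝ g y w u v) := by
  simp [christoffelFirst]

/-- Christoffel symbols (of the second kind): the index of `christoffelFirst` is raised with the
inverse of `g y`, seen as a map from `E` to its dual. Thus `christoffel g y u v` is the vector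
`Γ(u, v)` of the Levi-Civita connection of `g`. -/
def christoffel (g : E → E →L[ℝ] E →L[ℝ] ℝ) (y : E) : E →L[ℝ] E →L[ℝ] E :=
  (ContinuousLinearMap.compL ℝ E (E →L[ℝ] ℝ) E (g y).inverse).comp (christoffelFirst g y)

theorem christoffel_apply (g : E → E →L[ℝ] E →L[ℝ] ℝ) (y u v : E) :
    christoffel g y u v = (g y).inverse (christoffelFirst g y u v) := by
  simp [christoffel]

/-- For fixed `v, w`, the curvature endomorphism `u ↦ R(u, v) w` of the Levi-Civita connection,
where `R(u, v) w = ∇_u ∇_v w - ∇_v ∇_u w` for constant fields `u, v, w`;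
see `curvature_apply` for the formula. -/
def curvature (g : E → E →L[ℝ] E →L[ℝ] ℝ) (y v w : E) : E →L[ℝ] E :=
  ((fderiv ℝ (christoffel g) y).flip v).flip w - (fderiv ℝ (christoffel g) y v).flip w +
    (christoffel g y).flip (christoffel g y v w) -
    (christoffel g y v).comp ((christoffel g y).flip w)

theorem curvature_apply (g : E → E →L[ℝ] E →L[ℝ] ℝ) (y u v w : E) :
    curvature g y v w u =
      fderiv ℝ (christoffel g) y u v w - fderiv ℝ (christoffel g) y v u w +
        christoffel g y u (christoffel g y v w) - christoffel g y v (christoffel g y u w) := by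
  simp [curvature]

/-- The Ricci tensor in coordinates: `Ric(v, w)` is the trace of `u ↦ R(u, v) w`. -/
def ricciCoord [FiniteDimensional ℝ E] (g : E → E →L[ℝ] E →L[ℝ] ℝ) (y : E) :
    E →L[ℝ] E →L[ℝ] ℝ :=
  (LinearMap.mk₂ ℝ (fun v w : E => LinearMap.trace ℝ E (curvature g y v w : E →ₗ[ℝ] E))
    (fun v v' w => by
      rw [← map_add]; congr 1; ext u; simp [curvature_apply]; abel)
    (fun c v w => by
      rw [← map_smul]; congr 1; ext u; simp [curvature_apply, smul_sub, smul_add])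
    (fun v w w' => by
      rw [← map_add]; congr 1; ext u; simp [curvature_apply]; abel)
    (fun c v w => by
      rw [← map_smul]; congr 1; ext u; simp [curvature_apply, smul_sub, smul_add])
    ).toContinuousBilinearMap

theorem ricciCoord_apply [FiniteDimensional ℝ E] (g : E → E →L[ℝ] E →L[ℝ] ℝ) (y v w : E) :
    ricciCoord g y v w = LinearMap.trace ℝ E (curvature g y v w : E →ₗ[ℝ] E) := rfl

/-- The Lie derivative of a field of bilinear forms `T` along a vector field `X` on `E`,
see `lieDerivCoord_apply` for the formula. -/
def lieDerivCoord (X : E → E) (T : E → E →L[ℝ] E →L[ℝ] ℝ) (y : E) : E →L[ℝ] E →L[ℝ] ℝ :=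
  fderiv ℝ T y (X y) + (T y).comp (fderiv ℝ X y) + ((T y).flip.comp (fderiv ℝ X y)).flip

theorem lieDerivCoord_apply (X : E → E) (T : E → E →L[ℝ] E →L[ℝ] ℝ) (y u v : E) :
    lieDerivCoord X T y u v =
      fderiv ℝ T y (X y) u v + T y (fderiv ℝ X y u) v + T y u (fderiv ℝ X y v) := by
  simp [lieDerivCoord]

end Coordinates

/-! ## Covariant two-tensors on manifolds -/

section Manifolds

variable {E : Type*} [NormedAddCommGroup E] [NormedSpace ℝ E]
  {M : Type*} [TopologicalSpace M] [ChartedSpace E M]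
  {F : Type*} [NormedAddCommGroup F] [NormedSpace ℝ F]
  {N : Type*} [TopologicalSpace N] [ChartedSpace F N]

variable (E M) in
/-- (Not necessarily smooth) fields of bilinear forms on the tangent spaces of `M`. -/
abbrev TwoTensorField : Type _ :=
  ∀ x : M, TangentSpace 𝓘(ℝ, E) x →L[ℝ] TangentSpace 𝓘(ℝ, E) x →L[ℝ] ℝ

/-- The pullback `f^* T`, i.e. `(f^* T)_x (u, v) = T_{f x} (df_x u, df_x v)`. -/
def pullback (f : N → M) (T : TwoTensorField E M) : TwoTensorField F N := fun x =>
  (ContinuousLinearMap.precomp ℝ (mfderiv 𝓘(ℝ, F) 𝓘(ℝ, E) f x)).comp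
    ((T (f x)).comp (mfderiv 𝓘(ℝ, F) 𝓘(ℝ, E) f x))

theorem pullback_apply (f : N → M) (T : TwoTensorField E M) (x : N)
    (u v : TangentSpace 𝓘(ℝ, F) x) :
    pullback f T x u v =
      T (f x) (mfderiv 𝓘(ℝ, F) 𝓘(ℝ, E) f x u) (mfderiv 𝓘(ℝ, F) 𝓘(ℝ, E) f x v) := rfl

/-- Coordinate expression of a two-tensor field in the preferred chart at `x₀`. -/
def tensorInChart (T : TwoTensorField E M) (x₀ : M) : E → E →L[ℝ] E →L[ℝ] ℝ :=
  pullback (F := E) (N := E) (extChartAt 𝓘(ℝ, E) x₀).symm T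

theorem tensorInChart_apply (T : TwoTensorField E M) (x₀ : M) (y u v : E) :
    tensorInChart T x₀ y u v =
      T ((extChartAt 𝓘(ℝ, E) x₀).symm y)
        (mfderiv 𝓘(ℝ, E) 𝓘(ℝ, E) (extChartAt 𝓘(ℝ, E) x₀).symm y u)
        (mfderiv 𝓘(ℝ, E) 𝓘(ℝ, E) (extChartAt 𝓘(ℝ, E) x₀).symm y v) := rfl

/-- Coordinate expression of a vector field in the preferred chart at `x₀`. -/
def vectorInChart (X : ∀ x : M, TangentSpace 𝓘(ℝ, E) x) (x₀ : M) : E → E :=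
  mpullback 𝓘(ℝ, E) 𝓘(ℝ, E) (extChartAt 𝓘(ℝ, E) x₀).symm X

/-- The Lie derivative along `X` of a two-tensor field, computed at each point in the preferred
chart there. -/
def lieDeriv (X : ∀ x : M, TangentSpace 𝓘(ℝ, E) x) (T : TwoTensorField E M) :
    TwoTensorField E M := fun x =>
  pullback (E := E) (M := E) (extChartAt 𝓘(ℝ, E) x)
    (lieDerivCoord (vectorInChart X x) (tensorInChart T x)) x

theorem lieDeriv_apply (X : ∀ x : M, TangentSpace 𝓘(ℝ, E) x) (T : TwoTensorField E M) (x : M)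
    (u v : TangentSpace 𝓘(ℝ, E) x) :
    lieDeriv X T x u v =
      lieDerivCoord (vectorInChart X x) (tensorInChart T x) (extChartAt 𝓘(ℝ, E) x x)
        (mfderiv 𝓘(ℝ, E) 𝓘(ℝ, E) (extChartAt 𝓘(ℝ, E) x) x u)
        (mfderiv 𝓘(ℝ, E) 𝓘(ℝ, E) (extChartAt 𝓘(ℝ, E) x) x v) := rfl

variable (E M) in
/-- A smooth semi-Riemannian metric (of arbitrary signature) on `M`. -/
structure SemiRiemannianMetric [IsManifold 𝓘(ℝ, E) ∞ M] where
  /-- the metric tensor -/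
  val : TwoTensorField E M
  symm : ∀ (x : M) (v w : TangentSpace 𝓘(ℝ, E) x), val x v w = val x w v
  nondegenerate : ∀ (x : M) (v : TangentSpace 𝓘(ℝ, E) x), (∀ w, val x v w = 0) → v = 0
  contMDiff : ContMDiff 𝓘(ℝ, E) (𝓘(ℝ, E).prod 𝓘(ℝ, E →L[ℝ] E →L[ℝ] ℝ)) ∞
    (fun x : M => Bundle.TotalSpace.mk'
      (E := fun x : M => TangentSpace 𝓘(ℝ, E) x →L[ℝ] TangentSpace 𝓘(ℝ, E) x →L[ℝ] ℝ)
      (E →L[ℝ] E →L[ℝ] ℝ) x (val x))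

/-- The Ricci tensor of a metric, computed at each point in the preferred chart there. -/
def ricci [FiniteDimensional ℝ E] (g : TwoTensorField E M) : TwoTensorField E M := fun x =>
  pullback (E := E) (M := E) (extChartAt 𝓘(ℝ, E) x) (ricciCoord (tensorInChart g x)) x

theorem ricci_apply [FiniteDimensional ℝ E] (g : TwoTensorField E M) (x : M)
    (u v : TangentSpace 𝓘(ℝ, E) x) :
    ricci g x u v =
      ricciCoord (tensorInChart g x) (extChartAt 𝓘(ℝ, E) x x)
        (mfderiv 𝓘(ℝ, E) 𝓘(ℝ, E) (extChartAt 𝓘(ℝ, E) x) x u)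
        (mfderiv 𝓘(ℝ, E) 𝓘(ℝ, E) (extChartAt 𝓘(ℝ, E) x) x v) := rfl

/-- `Φ(N)` is a null hypersurface of `(M, g)`: the pullback `Φ^* g` is degenerate at each point. -/
def IsNull (Φ : N → M) (g : TwoTensorField E M) : Prop :=
  ∀ p : N, ∃ v : TangentSpace 𝓘(ℝ, F) p, v ≠ 0 ∧ ∀ w, pullback Φ g p v w = 0

/-- `ξ` is a rigging of the hypersurface `Φ(N)`: a smooth vector field on a neighbourhood `U`
of `Φ(N)`, everywhere transversal to `Φ(N)`. -/
structure IsRigging [IsManifold 𝓘(ℝ, E) ∞ M] (Φ : N → M) (U : Set M)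
    (ξ : ∀ x : M, TangentSpace 𝓘(ℝ, E) x) : Prop where
  isOpen : IsOpen U
  range_subset : range Φ ⊆ U
  contMDiffOn : ContMDiffOn 𝓘(ℝ, E) 𝓘(ℝ, E).tangent ∞
    (fun x => (⟨x, ξ x⟩ : TangentBundle 𝓘(ℝ, E) M)) U
  transversal : ∀ p : N, ξ (Φ p) ∉ range (mfderiv 𝓘(ℝ, F) 𝓘(ℝ, E) Φ p)

end Manifolds

/-! ## Metric hypersurface data -/

section HypersurfaceData

section Algebra

variable {V : Type*} [AddCommGroup V] [Module ℝ V] [TopologicalSpace V]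

/-- The bilinear form `𝒜((w, a), (v, b)) = γ(w, v) + a ℓ(v) + b ℓ(w) + a b ℓ₂` on `V × ℝ`, as a map
from `V × ℝ` to its dual. -/
def ambientForm (γ : V →L[ℝ] V →L[ℝ] ℝ) (l : V →L[ℝ] ℝ) (l₂ : ℝ) :
    (V × ℝ) →L[ℝ] (V × ℝ) →L[ℝ] ℝ :=
  (ContinuousLinearMap.precomp ℝ (ContinuousLinearMap.fst ℝ V ℝ)).comp
      (γ.comp (ContinuousLinearMap.fst ℝ V ℝ)) +
    (ContinuousLinearMap.snd ℝ V ℝ).smulRight (l.comp (ContinuousLinearMap.fst ℝ V ℝ)) +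
    (l.comp (ContinuousLinearMap.fst ℝ V ℝ)).smulRight (ContinuousLinearMap.snd ℝ V ℝ) +
    (l₂ • ContinuousLinearMap.snd ℝ V ℝ).smulRight (ContinuousLinearMap.snd ℝ V ℝ)

theorem ambientForm_apply (γ : V →L[ℝ] V →L[ℝ] ℝ) (l : V →L[ℝ] ℝ) (l₂ : ℝ) (w v : V) (a b : ℝ) :
    ambientForm γ l l₂ (w, a) (v, b) = γ w v + a * l v + b * l w + a * b * l₂ := by
  simp [ambientForm]; ring

/-- The inverse `𝒜^♯` of `𝒜`, as a map from the dual of `V × ℝ` to `V × ℝ`. The associated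
contravariant form is `𝒜^♯(A, B) = B (sharp A)`. -/
def sharp (γ : V →L[ℝ] V →L[ℝ] ℝ) (l : V →L[ℝ] ℝ) (l₂ : ℝ) :
    ((V × ℝ) →L[ℝ] ℝ) →L[ℝ] (V × ℝ) :=
  (ambientForm γ l l₂).inverse

/-- The vector `n`, given by `β(n) = 𝒜^♯((0, 1), (β, 0))`. -/
def nVec (γ : V →L[ℝ] V →L[ℝ] ℝ) (l : V →L[ℝ] ℝ) (l₂ : ℝ) : V :=
  (sharp γ l l₂ (ContinuousLinearMap.snd ℝ V ℝ)).1

/-- The contravariant tensor `P`, given by `P(α, β) = 𝒜^♯((α, 0), (β, 0))`, as a map from the dual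
of `V` to `V`: `P(α, β) = β (pMap α)`. -/
def pMap (γ : V →L[ℝ] V →L[ℝ] ℝ) (l : V →L[ℝ] ℝ) (l₂ : ℝ) : (V →L[ℝ] ℝ) →L[ℝ] V :=
  ((ContinuousLinearMap.fst ℝ V ℝ).comp (sharp γ l l₂)).comp
    (ContinuousLinearMap.precomp ℝ (ContinuousLinearMap.fst ℝ V ℝ))

/-- The contraction `P^{ab} B_{ab}`, i.e. the trace of `v ↦ P(B(v, ·), ·)`. -/
def trP (γ : V →L[ℝ] V →L[ℝ] ℝ) (l : V →L[ℝ] ℝ) (l₂ : ℝ) (B : V →L[ℝ] V →L[ℝ] ℝ) : ℝ :=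
  LinearMap.trace ℝ V (((pMap γ l l₂).comp B : V →L[ℝ] V) : V →ₗ[ℝ] V)

end Algebra

variable {E : Type*} [NormedAddCommGroup E] [NormedSpace ℝ E]
  {M : Type*} [TopologicalSpace M] [ChartedSpace E M]
  {F : Type*} [NormedAddCommGroup F] [NormedSpace ℝ F]
  {N : Type*} [TopologicalSpace N] [ChartedSpace F N]

/-- The one-form `ℓ = Φ^*(g(ξ, ·))` at `p`. -/
def ellForm (Φ : N → M) (g : TwoTensorField E M) (ξ : ∀ x : M, TangentSpace 𝓘(ℝ, E) x) (p : N) :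
    TangentSpace 𝓘(ℝ, F) p →L[ℝ] ℝ :=
  (g (Φ p) (ξ (Φ p))).comp (mfderiv 𝓘(ℝ, F) 𝓘(ℝ, E) Φ p)

/-- The scalar `ℓ₂ = Φ^*(g(ξ, ξ))` at `p`. -/
def ellTwo (Φ : N → M) (g : TwoTensorField E M) (ξ : ∀ x : M, TangentSpace 𝓘(ℝ, E) x) (p : N) : ℝ :=
  g (Φ p) (ξ (Φ p)) (ξ (Φ p))

variable (F) in
/-- The vector field `n` on `N` determined by the metric hypersurface data induced by
`(Φ, ξ)` from `g`. -/
def nField (Φ : N → M) (g : TwoTensorField E M) (ξ : ∀ x : M, TangentSpace 𝓘(ℝ, E) x) (p : N) :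
    TangentSpace 𝓘(ℝ, F) p :=
  nVec (pullback Φ g p) (ellForm Φ g ξ p) (ellTwo Φ g ξ p)

/-- The function `P^{ab} B_{ab}` on `N`, for `P` determined by the metric hypersurface data induced
by `(Φ, ξ)` from `g`. -/
def traceP (Φ : N → M) (g : TwoTensorField E M) (ξ : ∀ x : M, TangentSpace 𝓘(ℝ, E) x)
    (B : TwoTensorField F N) (p : N) : ℝ :=
  trP (pullback Φ g p) (ellForm Φ g ξ p) (ellTwo Φ g ξ p) (B p)

end HypersurfaceData

end NullHypersurface

end

/-!
The tensor `T = Ric - λ g` satisfies the contracted Bianchi identity `2 div T = d (tr T)`, because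
`g` is parallel and the trace of `λ g` is constant (`IsMetricOn.contracted_bianchi`). This is a
first-order linear differential equation for `T`, valid on a whole neighbourhood of the
hypersurface. By hypothesis `T` and its first `m - 1` Lie derivatives along the rigging `ξ` vanish
on the hypersurface, so `T` vanishes there to order `m` and only the principal symbol survives when
the equation is differentiated `m - 1` times along `ξ`: with `S` the `m`-th Lie derivative of `T`
and `α` the conormal normalized by `α(ξ) = 1`,
`2 S(v, grad α) = α(v) tr S` for all vectors `v` at points of the hypersurface
(`IsMetricOn.bianchiSymbol_iterate_lieDerivCoord`).

The general fact behind this step is `iterate_derivAlong_firstOrderOp`. It is proved by induction on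
the order, using only that the commutator of a first-order operator with the derivative along `ξ` is
again of first order, and that the derivative of a function vanishing on the hypersurface is `α`
times its derivative along `ξ`. In particular neither coordinates adapted to the hypersurface nor a
flow box for `ξ` are needed.

As the hypersurface is null, `grad α` is tangent to it and equals `n`. Taking `v` tangent gives
`S(n, v) = 0`. Taking `v = ξ` gives `2 S(n, ξ) = tr S`, and since `n⁽²⁾ = 0` the trace decomposes as
`tr S = tr_P S + 2 S(n, ξ)`, whence `tr_P S = 0` (`nVec_and_trP_eq_zero`).

The argument takes place in a single chart around a point of the hypersurface. The Ricci tensor and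
the Lie derivative are defined pointwise, each in the preferred chart of the point, so their
coordinate formulas have to be shown invariant under changes of coordinates (`ricciCoord_pullback`,
`lieDerivCoord_pullback`); for the Ricci tensor this goes through the transformation law of the
Christoffel symbols.
-/

noncomputable section

namespace NullHypersurface

open Set Topology VectorField

/-! ### First-order operators and functions vanishing along a hypersurface -/

section FirstOrder

variable {E : Type*} [NormedAddCommGroup E] [NormedSpace ℝ E]
  {W : Type*} [NormedAddCommGroup W] [NormedSpace ℝ W]
  {W' : Type*} [NormedAddCommGroup W'] [NormedSpace ℝ W']
  {Ω : Set E}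

theorem _root_.ContDiffOn.fderiv_infty {f : E → W} (hf : ContDiffOn ℝ ∞ f Ω) (hΩ : IsOpen Ω) :
    ContDiffOn ℝ ∞ (fderiv ℝ f) Ω :=
  hf.fderiv_of_isOpen hΩ (by simp)

theorem _root_.ContDiffOn.differentiableAt_of_mem {f : E → W} (hf : ContDiffOn ℝ ∞ f Ω)
    (hΩ : IsOpen Ω) {y : E} (hy : y ∈ Ω) : DifferentiableAt ℝ f y :=
  (hf.contDiffAt (hΩ.mem_nhds hy)).differentiableAt (by simp)

theorem _root_.ContDiffOn.fderiv_fderiv_comm {f : E → W} (hf : ContDiffOn ℝ ∞ f Ω)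
    (hΩ : IsOpen Ω) {y : E} (hy : y ∈ Ω) (u v : E) :
    fderiv ℝ (fderiv ℝ f) y u v = fderiv ℝ (fderiv ℝ f) y v u :=
  ((hf.contDiffAt (hΩ.mem_nhds hy)).isSymmSndFDerivAt
    (by simpa using ENat.LEInfty.out)).eq u v

/-- The operator `T ↦ X T + A T`, where `X T` is the derivative of the vector-valued function `T`
along the vector field `X`, and `A` is a field of endomorphisms. The Lie derivative along `X` of
tensor fields has this form in coordinates. -/
def derivAlong (X : E → E) (A : E → W →L[ℝ] W) (T : E → W) (y : E) : W :=
  fderiv ℝ T y (X y) + A y (T y)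

/-- The first-order linear differential operator `T ↦ L (DT) + C T`. -/
def firstOrderOp (L : E → (E →L[ℝ] W) →L[ℝ] W') (C : E → W →L[ℝ] W') (T : E → W) (y : E) : W' :=
  L y (fderiv ℝ T y) + C y (T y)

theorem contDiffOn_derivAlong (hΩ : IsOpen Ω) {X : E → E} (hX : ContDiffOn ℝ ∞ X Ω)
    {A : E → W →L[ℝ] W} (hA : ContDiffOn ℝ ∞ A Ω) {T : E → W} (hT : ContDiffOn ℝ ∞ T Ω) :
    ContDiffOn ℝ ∞ (derivAlong X A T) Ω :=
  ((hT.fderiv_infty hΩ).clm_apply hX).add (hA.clm_apply hT)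

theorem contDiffOn_firstOrderOp (hΩ : IsOpen Ω) {L : E → (E →L[ℝ] W) →L[ℝ] W'}
    (hL : ContDiffOn ℝ ∞ L Ω) {C : E → W →L[ℝ] W'} (hC : ContDiffOn ℝ ∞ C Ω) {T : E → W}
    (hT : ContDiffOn ℝ ∞ T Ω) : ContDiffOn ℝ ∞ (firstOrderOp L C T) Ω :=
  (hL.clm_apply (hT.fderiv_infty hΩ)).add (hC.clm_apply hT)

theorem contDiffOn_iterate_derivAlong (hΩ : IsOpen Ω) {X : E → E} (hX : ContDiffOn ℝ ∞ X Ω)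
    {A : E → W →L[ℝ] W} (hA : ContDiffOn ℝ ∞ A Ω) {T : E → W} (hT : ContDiffOn ℝ ∞ T Ω) (k : ℕ) :
    ContDiffOn ℝ ∞ ((derivAlong X A)^[k] T) Ω := by
  induction k with
  | zero => exact hT
  | succ k ih =>
    rw [Function.iterate_succ_apply']
    exact contDiffOn_derivAlong hΩ hX hA ih

theorem eqOn_derivAlong (hΩ : IsOpen Ω) {X : E → E} {A : E → W →L[ℝ] W} {f g : E → W}
    (h : EqOn f g Ω) : EqOn (derivAlong X A f) (derivAlong X A g) Ω := fun y hy => by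
  have : f =ᶠ[𝓝 y] g := Filter.eventuallyEq_of_mem (hΩ.mem_nhds hy) h
  simp only [derivAlong, this.fderiv_eq, h hy]

theorem eqOn_iterate_derivAlong (hΩ : IsOpen Ω) {X : E → E} {A : E → W →L[ℝ] W} {f g : E → W}
    (h : EqOn f g Ω) (k : ℕ) : EqOn ((derivAlong X A)^[k] f) ((derivAlong X A)^[k] g) Ω := by
  induction k with
  | zero => exact h
  | succ k ih =>
    rw [Function.iterate_succ_apply', Function.iterate_succ_apply']
    exact eqOn_derivAlong hΩ ih

theorem iterate_derivAlong_add (hΩ : IsOpen Ω) {X : E → E} (hX : ContDiffOn ℝ ∞ X Ω)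
    {A : E → W →L[ℝ] W} (hA : ContDiffOn ℝ ∞ A Ω) {f g : E → W} (hf : ContDiffOn ℝ ∞ f Ω)
    (hg : ContDiffOn ℝ ∞ g Ω) (k : ℕ) :
    EqOn ((derivAlong X A)^[k] (fun y => f y + g y))
      (fun y => (derivAlong X A)^[k] f y + (derivAlong X A)^[k] g y) Ω := by
  induction k with
  | zero => exact fun _ _ => rfl
  | succ k ih =>
    intro y hy
    rw [Function.iterate_succ_apply', Function.iterate_succ_apply', Function.iterate_succ_apply',
      eqOn_derivAlong hΩ ih hy]
    have h1 := (contDiffOn_iterate_derivAlong hΩ hX hA hf k).differentiableAt_of_mem hΩ hy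
    have h2 := (contDiffOn_iterate_derivAlong hΩ hX hA hg k).differentiableAt_of_mem hΩ hy
    simp only [derivAlong, fderiv_fun_add h1 h2, add_apply, map_add]
    abel

theorem iterate_derivAlong_sub_smul (hΩ : IsOpen Ω) {X : E → E} (hX : ContDiffOn ℝ ∞ X Ω)
    {A : E → W →L[ℝ] W} (hA : ContDiffOn ℝ ∞ A Ω) {f g : E → W} (hf : ContDiffOn ℝ ∞ f Ω)
    (hg : ContDiffOn ℝ ∞ g Ω) (c : ℝ) (k : ℕ) :
    EqOn ((derivAlong X A)^[k] (fun y => f y - c • g y))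
      (fun y => (derivAlong X A)^[k] f y - c • (derivAlong X A)^[k] g y) Ω := by
  induction k with
  | zero => exact fun _ _ => rfl
  | succ k ih =>
    intro y hy
    rw [Function.iterate_succ_apply', Function.iterate_succ_apply', Function.iterate_succ_apply',
      eqOn_derivAlong hΩ ih hy]
    have h1 := (contDiffOn_iterate_derivAlong hΩ hX hA hf k).differentiableAt_of_mem hΩ hy
    have h2 := (contDiffOn_iterate_derivAlong hΩ hX hA hg k).differentiableAt_of_mem hΩ hy
    simp only [derivAlong, fderiv_fun_sub h1 (h2.fun_const_smul c), fderiv_fun_const_smul h2,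
      sub_apply, smul_apply, map_sub, map_smul, smul_add]
    abel

/-- The commutator of a first-order operator with the derivative along `X` is again a first-order
operator. -/
theorem derivAlong_firstOrderOp (hΩ : IsOpen Ω) {X : E → E} (hX : ContDiffOn ℝ ∞ X Ω)
    {A : E → W →L[ℝ] W} (hA : ContDiffOn ℝ ∞ A Ω)
    {L : E → (E →L[ℝ] W) →L[ℝ] W'} (hL : ContDiffOn ℝ ∞ L Ω)
    {C : E → W →L[ℝ] W'} (hC : ContDiffOn ℝ ∞ C Ω) :
    ∃ (L' : E → (E →L[ℝ] W) →L[ℝ] W') (C' : E → W →L[ℝ] W'),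
      ContDiffOn ℝ ∞ L' Ω ∧ ContDiffOn ℝ ∞ C' Ω ∧ ∀ T : E → W, ContDiffOn ℝ ∞ T Ω →
        EqOn (derivAlong X 0 (firstOrderOp L C T))
          (fun y => firstOrderOp L C (derivAlong X A T) y + firstOrderOp L' C' T y) Ω := by
  refine ⟨fun y => fderiv ℝ L y (X y) -
      (L y).comp ((ContinuousLinearMap.compL ℝ E E W).flip (fderiv ℝ X y)) -
      (L y).comp (ContinuousLinearMap.compL ℝ E W W (A y)),
    fun y => fderiv ℝ C y (X y) - (L y).comp (fderiv ℝ A y).flip - (C y).comp (A y),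
    ?_, ?_, ?_⟩
  · refine (((hL.fderiv_infty hΩ).clm_apply hX).sub (hL.clm_comp ?_)).sub (hL.clm_comp ?_)
    · exact ((ContinuousLinearMap.compL ℝ E E W).flip.contDiff).comp_contDiffOn
        (hX.fderiv_infty hΩ)
    · exact (ContinuousLinearMap.compL ℝ E W W).contDiff.comp_contDiffOn hA
  · refine (((hC.fderiv_infty hΩ).clm_apply hX).sub (hL.clm_comp ?_)).sub (hC.clm_comp hA)
    exact ((ContinuousLinearMap.flipₗᵢ ℝ E W W).toContinuousLinearEquiv.contDiff).comp_contDiffOn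
      (hA.fderiv_infty hΩ)
  · intro T hT y hy
    have dX := hX.differentiableAt_of_mem hΩ hy
    have dA := hA.differentiableAt_of_mem hΩ hy
    have dL := hL.differentiableAt_of_mem hΩ hy
    have dC := hC.differentiableAt_of_mem hΩ hy
    have dT := hT.differentiableAt_of_mem hΩ hy
    have dT2 := (hT.fderiv_infty hΩ).differentiableAt_of_mem hΩ hy
    have e1 : fderiv ℝ (firstOrderOp L C T) y (X y) =
        fderiv ℝ L y (X y) (fderiv ℝ T y) + L y (fderiv ℝ (fderiv ℝ T) y (X y)) +
          (fderiv ℝ C y (X y) (T y) + C y (fderiv ℝ T y (X y))) := by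
      unfold firstOrderOp
      rw [fderiv_fun_add (dL.clm_apply dT2) (dC.clm_apply dT), fderiv_clm_apply dL dT2,
        fderiv_clm_apply dC dT]
      simp [add_comm]
    have e2 : fderiv ℝ (derivAlong X A T) y =
        fderiv ℝ (fderiv ℝ T) y (X y) + (fderiv ℝ T y).comp (fderiv ℝ X y) +
          (fderiv ℝ A y).flip (T y) + (A y).comp (fderiv ℝ T y) := by
      unfold derivAlong
      rw [fderiv_fun_add (dT2.clm_apply dX) (dA.clm_apply dT), fderiv_clm_apply dT2 dX,
        fderiv_clm_apply dA dT]
      ext v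
      simp only [add_apply, ContinuousLinearMap.comp_apply,
        ContinuousLinearMap.flip_apply, hT.fderiv_fderiv_comm hΩ hy v (X y)]
      abel
    rw [derivAlong, e1]
    simp only [firstOrderOp, e2, map_add]
    simp only [derivAlong, Pi.zero_apply, zero_apply, map_add,
      sub_apply, ContinuousLinearMap.comp_apply,
      ContinuousLinearMap.flip_apply, ContinuousLinearMap.compL_apply]
    abel

/-- Let `T` vanish along `H` together with its first `m` derivatives along the transversal field
`X`. Then, at a point `y₀` of `H` with conormal `α`, a first-order operator applied to `T` vanishes
to order `m`, and its `m`-th derivative along `X` is the principal symbol of the operator at `α`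
applied to the `(m + 1)`-st derivative of `T`. The hypothesis `hH` says that the derivative at `y₀`
of a function vanishing on `H` is determined by its value in the direction `X`. -/
theorem iterate_derivAlong_firstOrderOp (hΩ : IsOpen Ω) {X : E → E} (hX : ContDiffOn ℝ ∞ X Ω)
    {A : E → W →L[ℝ] W} (hA : ContDiffOn ℝ ∞ A Ω) {H : Set E} {y₀ : E} (hy₀ : y₀ ∈ Ω)
    (hy₀H : y₀ ∈ H) {α : E →L[ℝ] ℝ}
    (hH : ∀ f : E → W, DifferentiableAt ℝ f y₀ → (∀ z ∈ H, f z = 0) →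
      fderiv ℝ f y₀ = α.smulRight (fderiv ℝ f y₀ (X y₀))) (m : ℕ) :
    ∀ {L : E → (E →L[ℝ] W) →L[ℝ] W'}, ContDiffOn ℝ ∞ L Ω →
    ∀ {C : E → W →L[ℝ] W'}, ContDiffOn ℝ ∞ C Ω → ∀ {T : E → W}, ContDiffOn ℝ ∞ T Ω →
    (∀ i ≤ m, ∀ z ∈ H, (derivAlong X A)^[i] T z = 0) →
    (∀ i < m, (derivAlong X 0)^[i] (firstOrderOp L C T) y₀ = 0) ∧
      (derivAlong X 0)^[m] (firstOrderOp L C T) y₀ =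
        L y₀ (α.smulRight ((derivAlong X A)^[m + 1] T y₀)) := by
  have base : ∀ {L : E → (E →L[ℝ] W) →L[ℝ] W'} {C : E → W →L[ℝ] W'} {T : E → W},
      ContDiffOn ℝ ∞ T Ω → (∀ z ∈ H, T z = 0) →
      firstOrderOp L C T y₀ = L y₀ (α.smulRight (derivAlong X A T y₀)) := by
    intro L C T hT h0
    have := hH T (hT.differentiableAt_of_mem hΩ hy₀) h0
    rw [firstOrderOp, derivAlong, h0 y₀ hy₀H]
    simp only [map_zero, add_zero]
    rw [← this]
  have zero0 : ContDiffOn ℝ ∞ (0 : E → W' →L[ℝ] W') Ω := contDiffOn_const (c := 0)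
  induction m with
  | zero =>
    intro L hL C hC T hT h
    refine ⟨by simp, ?_⟩
    exact base hT (h 0 le_rfl)
  | succ m ih =>
    intro L hL C hC T hT h
    obtain ⟨L', C', hL', hC', hcomm⟩ := derivAlong_firstOrderOp hΩ hX hA hL hC
    have hT' := contDiffOn_derivAlong hΩ hX hA hT
    obtain ⟨a1, a2⟩ := ih hL hC hT' (fun i hi z hz => by
      rw [← Function.iterate_succ_apply]; exact h (i + 1) (by lia) z hz)
    obtain ⟨b1, b2⟩ := ih hL' hC' hT (fun i hi z hz => h i (by lia) z hz)
    -- one derivative along `X` is traded for the operator applied to `X T + A T`, which vanishes to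
    -- order `m`; the commutator applied to `T` itself does not contribute
    have key : ∀ i, (derivAlong X 0)^[i + 1] (firstOrderOp L C T) y₀ =
        (derivAlong X 0)^[i] (firstOrderOp L C (derivAlong X A T)) y₀ +
          (derivAlong X 0)^[i] (firstOrderOp L' C' T) y₀ := by
      intro i
      rw [Function.iterate_succ_apply, eqOn_iterate_derivAlong hΩ (hcomm T hT) i hy₀,
        iterate_derivAlong_add hΩ hX zero0 (contDiffOn_firstOrderOp hΩ hL hC hT')
          (contDiffOn_firstOrderOp hΩ hL' hC' hT) i hy₀]
    have hsymb : (0 : W') = L' y₀ (α.smulRight ((derivAlong X A)^[m + 1] T y₀)) := by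
      rw [h (m + 1) le_rfl y₀ hy₀H]; simp
    refine ⟨?_, ?_⟩
    · rintro (_ | i) hi
      · have h1 := h 1 (by lia) y₀ hy₀H
        simp only [Function.iterate_succ, Function.iterate_zero, Function.comp_apply, id] at h1 ⊢
        rw [base hT (h 0 (by lia)), h1]
        simp
      · rw [key, a1 i (by lia), b1 i (by lia), add_zero]
    · rw [key, a2, b2, ← hsymb, add_zero, ← Function.iterate_succ_apply]

end FirstOrder

/-! ### Metric traces on a vector space -/

section MetricTrace

variable {E : Type*} [NormedAddCommGroup E] [NormedSpace ℝ E] [FiniteDimensional ℝ E]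

theorem isInvertible_of_nondegenerate {g : E →L[ℝ] E →L[ℝ] ℝ}
    (hg : ∀ v, (∀ w, g v w = 0) → v = 0) : g.IsInvertible := by
  have hfin : Module.finrank ℝ E = Module.finrank ℝ (E →L[ℝ] ℝ) := by
    rw [← (LinearMap.toContinuousLinearMap (𝕜 := ℝ) (E := E) (F' := ℝ)).finrank_eq]
    exact (Subspace.dual_finrank_eq).symm
  have hinj : Function.Injective (g : E →ₗ[ℝ] E →L[ℝ] ℝ) := by
    rw [← LinearMap.ker_eq_bot, LinearMap.ker_eq_bot']
    intro v hv
    exact hg v fun w => by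
      have := congrArg (fun f : E →L[ℝ] ℝ => f w) hv
      simpa using this
  have hsurj := (LinearMap.injective_iff_surjective_of_finrank_eq_finrank hfin).1 hinj
  refine ⟨(LinearEquiv.ofBijective (g : E →ₗ[ℝ] E →L[ℝ] ℝ)
    ⟨hinj, hsurj⟩).toContinuousLinearEquiv, ?_⟩
  ext v w
  rfl

theorem apply_inverse_apply {V V' : Type*} [AddCommGroup V] [Module ℝ V] [TopologicalSpace V]
    [AddCommGroup V'] [Module ℝ V'] [TopologicalSpace V'] {g : V →L[ℝ] V'} (hg : g.IsInvertible)
    (φ : V') : g (g.inverse φ) = φ := by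
  obtain ⟨e, rfl⟩ := hg
  simp

theorem inverse_apply_apply {V V' : Type*} [AddCommGroup V] [Module ℝ V] [TopologicalSpace V]
    [AddCommGroup V'] [Module ℝ V'] [TopologicalSpace V'] {g : V →L[ℝ] V'} (hg : g.IsInvertible)
    (v : V) : g.inverse (g v) = v := by
  obtain ⟨e, rfl⟩ := hg
  simp

variable (E) in
/-- A basis of `E`. -/
def frame : Module.Basis (Fin (Module.finrank ℝ E)) ℝ E := Module.finBasis ℝ E

/-- The coordinate functionals of `frame E`. -/
def coframe (j : Fin (Module.finrank ℝ E)) : E →L[ℝ] ℝ :=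
  LinearMap.toContinuousLinearMap ((frame E).coord j)

/-- The vector metrically equivalent to a coordinate functional of `frame E`; these vectors form the
`g`-dual basis of `frame E`. -/
def dualFrame (g : E →L[ℝ] E →L[ℝ] ℝ) (j : Fin (Module.finrank ℝ E)) : E :=
  g.inverse (coframe j)

theorem sum_coframe_smul (v : E) : ∑ j, coframe j v • frame E j = v :=
  (frame E).sum_repr v

theorem trace_eq_sum_coframe (A : E →ₗ[ℝ] E) :
    LinearMap.trace ℝ E A = ∑ j, coframe j (A (frame E j)) := by
  rw [LinearMap.trace_eq_matrix_trace ℝ (frame E), Matrix.trace]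
  simp [LinearMap.toMatrix_apply, coframe]

variable {g : E →L[ℝ] E →L[ℝ] ℝ}

theorem apply_dualFrame (hg : g.IsInvertible) (hs : ∀ v w, g v w = g w v)
    (j : Fin (Module.finrank ℝ E)) (v : E) : g v (dualFrame g j) = coframe j v := by
  rw [hs, dualFrame, apply_inverse_apply hg]

theorem trace_eq_sum (hg : g.IsInvertible) (hs : ∀ v w, g v w = g w v) (A : E →ₗ[ℝ] E) :
    LinearMap.trace ℝ E A = ∑ j, g (A (frame E j)) (dualFrame g j) := by
  simp only [trace_eq_sum_coframe, apply_dualFrame hg hs]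

theorem trace_inverse_comp (hg : g.IsInvertible) (hs : ∀ v w, g v w = g w v)
    (B : E →L[ℝ] E →L[ℝ] ℝ) :
    LinearMap.trace ℝ E ((g.inverse.comp B : E →L[ℝ] E) : E →ₗ[ℝ] E) =
      ∑ j, B (frame E j) (dualFrame g j) := by
  rw [trace_eq_sum hg hs]
  simp [apply_inverse_apply hg]

theorem trace_eq_zero_of_skew (hg : g.IsInvertible) (hs : ∀ v w, g v w = g w v) {A : E →ₗ[ℝ] E}
    (hA : ∀ v w, g (A v) w = - g v (A w)) : LinearMap.trace ℝ E A = 0 := by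
  have h2 : ∑ i, g (A (dualFrame g i)) (frame E i) = LinearMap.trace ℝ E A := by
    have : ∀ i, g (A (dualFrame g i)) (frame E i) = ∑ k, coframe k (dualFrame g i) *
        g (A (frame E k)) (frame E i) := fun i => by
      conv_lhs => rw [← sum_coframe_smul (dualFrame g i)]
      simp
    simp only [this]
    rw [Finset.sum_comm, trace_eq_sum hg hs]
    refine Finset.sum_congr rfl fun k _ => ?_
    conv_rhs => rw [← sum_coframe_smul (dualFrame g k)]
    rw [map_sum]
    refine Finset.sum_congr rfl fun i _ => ?_
    rw [map_smul, smul_eq_mul, ← apply_dualFrame hg hs, hs, apply_dualFrame hg hs]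
  have h1 : LinearMap.trace ℝ E A = - LinearMap.trace ℝ E A := by
    conv_rhs => rw [← h2]
    rw [trace_eq_sum hg hs, ← Finset.sum_neg_distrib]
    refine Finset.sum_congr rfl fun i _ => ?_
    rw [hA, hs]
  linarith

/-- The double trace of the second Bianchi identity, for a multilinear map `Q` with the symmetries
of the covariant derivative of a curvature tensor; the traces are written in a frame. -/
theorem sum_contracted_bianchi (hs : ∀ v w, g v w = g w v)
    {Q : E → E → E → E → E} (h1 : ∀ x u v w, Q x u v w = - Q x v u w)
    (h2 : ∀ x u v w, Q x u v w + Q u v x w + Q v x u w = 0)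
    (h3 : ∀ x u v w z, g (Q x u v w) z = - g w (Q x u v z)) (v : E) :
    2 * ∑ j, ∑ i, g (Q (frame E j) (frame E i) v (dualFrame g j)) (dualFrame g i) =
      ∑ j, ∑ i, g (Q v (frame E i) (frame E j) (dualFrame g j)) (dualFrame g i) := by
  have e : ∀ j i, g (Q (frame E j) (frame E i) v (dualFrame g j)) (dualFrame g i) +
      g (Q (frame E i) (frame E j) v (dualFrame g i)) (dualFrame g j) =
        g (Q v (frame E i) (frame E j) (dualFrame g j)) (dualFrame g i) := fun j i => by
    have := congrArg (fun z => g z (dualFrame g i))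
      (h2 (frame E j) (frame E i) v (dualFrame g j))
    simp only [map_add, add_apply, map_zero, zero_apply] at this
    rw [h1 v (frame E j), map_neg, neg_apply, h3 (frame E i), h1 (frame E i), map_neg, neg_neg,
      hs (dualFrame g j)] at this
    linarith
  have := Finset.sum_congr (rfl : Finset.univ = Finset.univ) fun j _ =>
    Finset.sum_congr (rfl : Finset.univ = Finset.univ) fun i _ => e j i
  rw [← this]
  simp only [Finset.sum_add_distrib]
  rw [two_mul]
  congr 1
  exact Finset.sum_comm

end MetricTrace

/-! ### The Levi-Civita connection in coordinates -/

section LeviCivita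

variable {E : Type*} [NormedAddCommGroup E] [NormedSpace ℝ E] [FiniteDimensional ℝ E]

/-- `G` is the coordinate expression of a smooth semi-Riemannian metric on the open set `Ω`. -/
structure IsMetricOn (G : E → E →L[ℝ] E →L[ℝ] ℝ) (Ω : Set E) : Prop where
  isOpen : IsOpen Ω
  contDiffOn : ContDiffOn ℝ ∞ G Ω
  symm : ∀ y ∈ Ω, ∀ v w, G y v w = G y w v
  nondegenerate : ∀ y ∈ Ω, ∀ v, (∀ w, G y v w = 0) → v = 0

omit [FiniteDimensional ℝ E] in
theorem fderiv_apply_vec {V W : Type*} [NormedAddCommGroup V] [NormedSpace ℝ V]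
    [NormedAddCommGroup W] [NormedSpace ℝ W] {f : E → V →L[ℝ] W} {y : E}
    (hf : DifferentiableAt ℝ f y) (v : V) (x : E) :
    fderiv ℝ (fun y => f y v) y x = fderiv ℝ f y x v := by
  rw [fderiv_clm_apply hf (differentiableAt_const v)]
  simp

omit [FiniteDimensional ℝ E] in
theorem fderiv_apply_vec₂ {V V' W : Type*} [NormedAddCommGroup V] [NormedSpace ℝ V]
    [NormedAddCommGroup V'] [NormedSpace ℝ V']
    [NormedAddCommGroup W] [NormedSpace ℝ W] {f : E → V →L[ℝ] V' →L[ℝ] W} {y : E}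
    (hf : DifferentiableAt ℝ f y) (v : V) (w : V') (x : E) :
    fderiv ℝ (fun y => f y v w) y x = fderiv ℝ f y x v w := by
  rw [fderiv_apply_vec (hf.clm_apply (differentiableAt_const v)), fderiv_apply_vec hf]

omit [FiniteDimensional ℝ E] in
/-- The Leibniz rule for a bilinear expression in two vector-valued functions. -/
theorem fderiv_bilin_apply {V V' W : Type*} [NormedAddCommGroup V] [NormedSpace ℝ V]
    [NormedAddCommGroup V'] [NormedSpace ℝ V']
    [NormedAddCommGroup W] [NormedSpace ℝ W] {f : E → V →L[ℝ] V' →L[ℝ] W} {a : E → V} {b : E → V'}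
    {y : E} (hf : DifferentiableAt ℝ f y) (ha : DifferentiableAt ℝ a y)
    (hb : DifferentiableAt ℝ b y) (x : E) :
    fderiv ℝ (fun y => f y (a y) (b y)) y x =
      fderiv ℝ f y x (a y) (b y) + f y (fderiv ℝ a y x) (b y) + f y (a y) (fderiv ℝ b y x) := by
  rw [fderiv_clm_apply (hf.clm_apply ha) hb, fderiv_clm_apply hf ha]
  simp only [add_apply, ContinuousLinearMap.comp_apply, ContinuousLinearMap.flip_apply]
  abel

omit [FiniteDimensional ℝ E] in
theorem curvature_antisymm (G : E → E →L[ℝ] E →L[ℝ] ℝ) (y u v w : E) :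
    curvature G y v w u = - curvature G y u w v := by
  rw [curvature_apply, curvature_apply]
  abel

namespace IsMetricOn

variable {G : E → E →L[ℝ] E →L[ℝ] ℝ} {Ω : Set E} (hG : IsMetricOn G Ω) {y : E}
include hG

theorem isInvertible (hy : y ∈ Ω) : (G y).IsInvertible :=
  isInvertible_of_nondegenerate (hG.nondegenerate y hy)

omit [FiniteDimensional ℝ E] in
theorem differentiableAt (hy : y ∈ Ω) : DifferentiableAt ℝ G y :=
  hG.contDiffOn.differentiableAt_of_mem hG.isOpen hy

theorem contDiffOn_inverse : ContDiffOn ℝ ∞ (fun y => (G y).inverse) Ω := fun y hy =>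
  ((hG.isInvertible hy).contDiffAt_map_inverse).comp_contDiffWithinAt y (hG.contDiffOn y hy)

omit [FiniteDimensional ℝ E] in
theorem eq_of_forall (hy : y ∈ Ω) {v v' : E} (h : ∀ w, G y v w = G y v' w) : v = v' :=
  sub_eq_zero.1 (hG.nondegenerate y hy _ fun w => by simp [h])

omit [FiniteDimensional ℝ E] in
theorem fderiv_symm (hy : y ∈ Ω) (x v w : E) : fderiv ℝ G y x v w = fderiv ℝ G y x w v := by
  rw [← fderiv_apply_vec₂ (hG.differentiableAt hy), ← fderiv_apply_vec₂ (hG.differentiableAt hy)]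
  have : (fun y => G y v w) =ᶠ[𝓝 y] fun y => G y w v :=
    Filter.eventuallyEq_of_mem (hG.isOpen.mem_nhds hy) fun z hz => hG.symm z hz v w
  rw [this.fderiv_eq]

theorem contDiffOn_christoffelFirst : ContDiffOn ℝ ∞ (christoffelFirst G) Ω := by
  have h := hG.contDiffOn.fderiv_infty hG.isOpen
  refine contDiffOn_clm_apply.2 fun u => contDiffOn_clm_apply.2 fun v =>
    contDiffOn_clm_apply.2 fun w => ?_
  simp only [christoffelFirst_apply]
  have h' : ∀ u v w : E, ContDiffOn ℝ ∞ (fun y => fderiv ℝ G y u v w) Ω := fun u v w =>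
    ((h.clm_apply contDiffOn_const).clm_apply contDiffOn_const).clm_apply contDiffOn_const
  exact contDiffOn_const.mul (((h' _ _ _).add (h' _ _ _)).sub (h' _ _ _))

theorem contDiffOn_christoffel : ContDiffOn ℝ ∞ (christoffel G) Ω :=
  ((ContinuousLinearMap.compL ℝ E (E →L[ℝ] ℝ) E).contDiff.comp_contDiffOn
    hG.contDiffOn_inverse).clm_comp hG.contDiffOn_christoffelFirst

theorem metric_christoffel (hy : y ∈ Ω) (u v w : E) :
    G y (christoffel G y u v) w = christoffelFirst G y u v w := by
  rw [christoffel_apply, apply_inverse_apply (hG.isInvertible hy)]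

omit [FiniteDimensional ℝ E] in
theorem christoffel_symm (hy : y ∈ Ω) (u v : E) : christoffel G y u v = christoffel G y v u := by
  rw [christoffel_apply, christoffel_apply]
  congr 1
  ext w
  rw [christoffelFirst_apply, christoffelFirst_apply, hG.fderiv_symm hy w u v]
  ring

/-- The metric is parallel. -/
theorem fderiv_eq (hy : y ∈ Ω) (x v w : E) :
    fderiv ℝ G y x v w = G y (christoffel G y x v) w + G y v (christoffel G y x w) := by
  rw [hG.symm y hy v, hG.metric_christoffel hy, hG.metric_christoffel hy, christoffelFirst_apply,
    christoffelFirst_apply, hG.fderiv_symm hy x w v]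
  ring

theorem differentiableAt_christoffel (hy : y ∈ Ω) : DifferentiableAt ℝ (christoffel G) y :=
  hG.contDiffOn_christoffel.differentiableAt_of_mem hG.isOpen hy

theorem differentiableAt_fderiv_christoffel (hy : y ∈ Ω) :
    DifferentiableAt ℝ (fderiv ℝ (christoffel G)) y :=
  (hG.contDiffOn_christoffel.fderiv_infty hG.isOpen).differentiableAt_of_mem hG.isOpen hy

theorem fderiv_christoffel_symm (hy : y ∈ Ω) (x v w : E) :
    fderiv ℝ (christoffel G) y x v w = fderiv ℝ (christoffel G) y x w v := by
  rw [← fderiv_apply_vec₂ (hG.differentiableAt_christoffel hy),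
    ← fderiv_apply_vec₂ (hG.differentiableAt_christoffel hy)]
  have : (fun y => christoffel G y v w) =ᶠ[𝓝 y] fun y => christoffel G y w v :=
    Filter.eventuallyEq_of_mem (hG.isOpen.mem_nhds hy) fun z hz => hG.christoffel_symm hz v w
  rw [this.fderiv_eq]

/-- The first Bianchi identity. -/
theorem first_bianchi (hy : y ∈ Ω) (u v w : E) :
    curvature G y v w u + curvature G y w u v + curvature G y u v w = 0 := by
  simp only [curvature_apply]
  rw [hG.fderiv_christoffel_symm hy u v w, hG.fderiv_christoffel_symm hy v w u,
    hG.fderiv_christoffel_symm hy w u v, hG.christoffel_symm hy v w, hG.christoffel_symm hy u w,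
    hG.christoffel_symm hy v u]
  abel

/-- The curvature endomorphisms are skew with respect to the metric. -/
theorem curvature_skew (hy : y ∈ Ω) (u v w z : E) :
    G y (curvature G y v w u) z = - G y w (curvature G y v z u) := by
  have dG := hG.differentiableAt hy
  have dΓ := hG.differentiableAt_christoffel hy
  have dΓ' : ∀ v w : E, DifferentiableAt ℝ (fun y => christoffel G y v w) y := fun v w =>
    (dΓ.clm_apply (differentiableAt_const v)).clm_apply (differentiableAt_const w)
  have dG2 := (hG.contDiffOn.fderiv_infty hG.isOpen).differentiableAt_of_mem hG.isOpen hy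
  have key : ∀ u v : E, fderiv ℝ (fderiv ℝ G) y u v w z =
      fderiv ℝ G y u (christoffel G y v w) z + G y (fderiv ℝ (christoffel G) y u v w) z +
        (fderiv ℝ G y u w (christoffel G y v z) + G y w (fderiv ℝ (christoffel G) y u v z)) := by
    intro u v
    have e : (fun y => fderiv ℝ G y v w z) =ᶠ[𝓝 y]
        fun y => G y (christoffel G y v w) z + G y w (christoffel G y v z) :=
      Filter.eventuallyEq_of_mem (hG.isOpen.mem_nhds hy) fun x hx => hG.fderiv_eq hx v w z
    have e' := congrArg (fun A : E →L[ℝ] ℝ => A u) e.fderiv_eq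
    rw [fderiv_apply_vec₂ (dG2.clm_apply (differentiableAt_const v)), fderiv_apply_vec dG2,
      fderiv_fun_add ((dG.clm_apply (dΓ' v w)).clm_apply (differentiableAt_const z))
        ((dG.clm_apply (differentiableAt_const w)).clm_apply (dΓ' v z)), add_apply,
      fderiv_bilin_apply dG (dΓ' v w) (differentiableAt_const z),
      fderiv_bilin_apply dG (differentiableAt_const w) (dΓ' v z),
      fderiv_apply_vec₂ dΓ, fderiv_apply_vec₂ dΓ] at e'
    simpa using e'
  have hcomm := hG.contDiffOn.fderiv_fderiv_comm hG.isOpen hy u v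
  have h1 := key u v
  rw [hcomm, key v u, hG.fderiv_eq hy, hG.fderiv_eq hy, hG.fderiv_eq hy, hG.fderiv_eq hy] at h1
  simp only [curvature_apply, map_add, map_sub, add_apply, sub_apply]
  linarith

theorem ricciCoord_symm (hy : y ∈ Ω) (v w : E) : ricciCoord G y v w = ricciCoord G y w v := by
  have hskew := trace_eq_zero_of_skew (hG.isInvertible hy) (hG.symm y hy)
    (A := (curvature G y v w : E →ₗ[ℝ] E) - (curvature G y w v : E →ₗ[ℝ] E)) (fun a b => by
      have h : ∀ a, curvature G y v w a - curvature G y w v a = - curvature G y w a v := fun a => by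
        have := hG.first_bianchi hy a v w
        rw [curvature_antisymm G y w a v] at this
        rw [← sub_eq_zero, ← this]
        abel
      simp only [LinearMap.sub_apply, ContinuousLinearMap.coe_coe, h, map_neg, neg_apply]
      rw [hG.curvature_skew hy])
  rw [ricciCoord_apply, ricciCoord_apply, ← sub_eq_zero, ← map_sub, hskew]

end IsMetricOn

end LeviCivita

/-! ### The contracted Bianchi identity -/

section Bianchi

variable {E : Type*} [NormedAddCommGroup E] [NormedSpace ℝ E]

/-- The covariant derivative `(∇_x R)(u, v) w` of the curvature tensor, in coordinates. -/
def covCurvature (G : E → E →L[ℝ] E →L[ℝ] ℝ) (y x u v w : E) : E :=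
  fderiv ℝ (fun y => curvature G y v w u) y x + christoffel G y x (curvature G y v w u) -
    curvature G y v (christoffel G y x w) u -
    (curvature G y v w (christoffel G y x u) + curvature G y (christoffel G y x v) w u)

/-- The covariant derivative `(∇_x T)(v, w)` of a field of bilinear forms, in coordinates. -/
def covDeriv (G T : E → E →L[ℝ] E →L[ℝ] ℝ) (y x v w : E) : ℝ :=
  fderiv ℝ T y x v w - T y (christoffel G y x v) w - T y v (christoffel G y x w)

theorem covCurvature_antisymm (G : E → E →L[ℝ] E →L[ℝ] ℝ) (y x u v w : E) :
    covCurvature G y x u v w = - covCurvature G y x v u w := by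
  have h : (fun y => curvature G y v w u) = fun y => - curvature G y u w v := by
    funext y; exact curvature_antisymm G y u v w
  rw [covCurvature, covCurvature, h, fderiv_fun_neg, neg_apply, curvature_antisymm G y u v w,
    curvature_antisymm G y u v, curvature_antisymm G y (christoffel G y x u) v w,
    curvature_antisymm G y u (christoffel G y x v), map_neg]
  abel

namespace IsMetricOn

variable [FiniteDimensional ℝ E]
  {G : E → E →L[ℝ] E →L[ℝ] ℝ} {Ω : Set E} (hG : IsMetricOn G Ω) {y : E}
include hG

theorem contDiffOn_curvature_apply (v w u : E) :
    ContDiffOn ℝ ∞ (fun y => curvature G y v w u) Ω := by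
  simp only [curvature_apply]
  have h := hG.contDiffOn_christoffel
  have h' := h.fderiv_infty hG.isOpen
  have c : ∀ v : E, ContDiffOn ℝ ∞ (fun _ : E => v) Ω := fun v => contDiffOn_const
  have k : ∀ u v : E, ContDiffOn ℝ ∞ (fun y => christoffel G y u v) Ω := fun u v =>
    (h.clm_apply (c u)).clm_apply (c v)
  have k' : ∀ u v w : E, ContDiffOn ℝ ∞ (fun y => fderiv ℝ (christoffel G) y u v w) Ω :=
    fun u v w => ((h'.clm_apply (c u)).clm_apply (c v)).clm_apply (c w)
  exact (((k' u v w).sub (k' v u w)).add ((h.clm_apply (c u)).clm_apply (k v w))).sub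
    ((h.clm_apply (c v)).clm_apply (k u w))

theorem differentiableAt_curvature_apply (hy : y ∈ Ω) (v w u : E) :
    DifferentiableAt ℝ (fun y => curvature G y v w u) y :=
  (hG.contDiffOn_curvature_apply v w u).differentiableAt_of_mem hG.isOpen hy

theorem fderiv_curvature (hy : y ∈ Ω) (x u v w : E) :
    fderiv ℝ (fun y => curvature G y v w u) y x =
      fderiv ℝ (fderiv ℝ (christoffel G)) y x u v w -
        fderiv ℝ (fderiv ℝ (christoffel G)) y x v u w +
      (fderiv ℝ (christoffel G) y x u (christoffel G y v w) +
        christoffel G y u (fderiv ℝ (christoffel G) y x v w)) -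
      (fderiv ℝ (christoffel G) y x v (christoffel G y u w) +
        christoffel G y v (fderiv ℝ (christoffel G) y x u w)) := by
  have dΓ := hG.differentiableAt_christoffel hy
  have dΓ2 := hG.differentiableAt_fderiv_christoffel hy
  have c : ∀ v : E, DifferentiableAt ℝ (fun _ : E => v) y := fun v => differentiableAt_const v
  have k : ∀ u v : E, DifferentiableAt ℝ (fun y => christoffel G y u v) y := fun u v =>
    (dΓ.clm_apply (c u)).clm_apply (c v)
  have k' : ∀ u v w : E, DifferentiableAt ℝ (fun y => fderiv ℝ (christoffel G) y u v w) y :=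
    fun u v w => ((dΓ2.clm_apply (c u)).clm_apply (c v)).clm_apply (c w)
  have kk : ∀ u v w : E, DifferentiableAt ℝ (fun y => christoffel G y u (christoffel G y v w)) y :=
    fun u v w => (dΓ.clm_apply (c u)).clm_apply (k v w)
  simp only [curvature_apply]
  rw [fderiv_fun_sub (((k' u v w).fun_sub (k' v u w)).fun_add (kk u v w)) (kk v u w),
    fderiv_fun_add ((k' u v w).fun_sub (k' v u w)) (kk u v w), fderiv_fun_sub (k' u v w) (k' v u w)]
  simp only [sub_apply, add_apply]
  rw [fderiv_bilin_apply dΓ (c u) (k v w), fderiv_bilin_apply dΓ (c v) (k u w),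
    fderiv_apply_vec₂ dΓ, fderiv_apply_vec₂ dΓ,
    fderiv_apply_vec₂ (dΓ2.clm_apply (c u)), fderiv_apply_vec₂ (dΓ2.clm_apply (c v)),
    fderiv_apply_vec dΓ2, fderiv_apply_vec dΓ2]
  simp

/-- The second Bianchi identity. -/
theorem second_bianchi (hy : y ∈ Ω) (x u v w : E) :
    covCurvature G y x u v w + covCurvature G y u v x w + covCurvature G y v x u w = 0 := by
  have h1 : ∀ x u v : E, curvature G y v w (christoffel G y x u) =
      - curvature G y (christoffel G y u x) w v := fun x u v => by
    rw [curvature_antisymm, hG.christoffel_symm hy]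
  have D2 : ∀ x u v : E, fderiv ℝ (fderiv ℝ (christoffel G)) y x u v w =
      fderiv ℝ (fderiv ℝ (christoffel G)) y u x v w := fun x u v => by
    rw [hG.contDiffOn_christoffel.fderiv_fderiv_comm hG.isOpen hy]
  have h2 : ∀ x u v : E, fderiv ℝ (fun y => curvature G y v w u) y x +
      christoffel G y x (curvature G y v w u) - curvature G y v (christoffel G y x w) u +
      (fderiv ℝ (fun y => curvature G y x w v) y u +
      christoffel G y u (curvature G y x w v) - curvature G y x (christoffel G y u w) v) +
      (fderiv ℝ (fun y => curvature G y u w x) y v +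
      christoffel G y v (curvature G y u w x) - curvature G y u (christoffel G y v w) x) = 0 := by
    intro x u v
    simp only [hG.fderiv_curvature hy]
    simp only [curvature_apply, map_add, map_sub]
    rw [D2 x u v, D2 x v u, D2 v u x]
    abel
  have h3 := h2 x u v
  simp only [covCurvature, h1]
  rw [← h3]
  abel

theorem covCurvature_skew (hy : y ∈ Ω) (x u v w z : E) :
    G y (covCurvature G y x u v w) z = - G y w (covCurvature G y x u v z) := by
  have dG := hG.differentiableAt hy
  have e : (fun y => G y (curvature G y v w u) z) =ᶠ[𝓝 y]
      fun y => - G y w (curvature G y v z u) :=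
    Filter.eventuallyEq_of_mem (hG.isOpen.mem_nhds hy) fun a ha => hG.curvature_skew ha u v w z
  have e' := congrArg (fun A : E →L[ℝ] ℝ => A x) e.fderiv_eq
  rw [fderiv_fun_neg, neg_apply,
    fderiv_bilin_apply dG (hG.differentiableAt_curvature_apply hy v w u) (differentiableAt_const z),
    fderiv_bilin_apply dG (differentiableAt_const w)
      (hG.differentiableAt_curvature_apply hy v z u),
    hG.fderiv_eq hy, hG.fderiv_eq hy] at e'
  have s1 := hG.curvature_skew hy u v (christoffel G y x w) z
  have s2 := hG.curvature_skew hy u v w (christoffel G y x z)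
  have s3 := hG.curvature_skew hy (christoffel G y x u) v w z
  have s4 := hG.curvature_skew hy u (christoffel G y x v) w z
  simp only [covCurvature, map_add, map_sub, add_apply, sub_apply]
  simp at e'
  linarith

theorem contDiffOn_ricciCoord : ContDiffOn ℝ ∞ (ricciCoord G) Ω := by
  refine contDiffOn_clm_apply.2 fun v => contDiffOn_clm_apply.2 fun w => ?_
  simp only [ricciCoord_apply, trace_eq_sum_coframe]
  exact ContDiffOn.sum fun j _ =>
    (coframe j).contDiff.comp_contDiffOn (hG.contDiffOn_curvature_apply v w _)

/-- The covariant derivative commutes with the contraction defining the Ricci tensor. -/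
theorem covDeriv_ricciCoord (hy : y ∈ Ω) (x v w : E) :
    covDeriv G (ricciCoord G) y x v w =
      ∑ i, G y (covCurvature G y x (frame E i) v w) (dualFrame (G y) i) := by
  simp only [apply_dualFrame (hG.isInvertible hy) (hG.symm y hy)]
  have hR := hG.contDiffOn_ricciCoord.differentiableAt_of_mem hG.isOpen hy
  have hf : (fun y => ricciCoord G y v w) =
      fun y => ∑ j, coframe j (curvature G y v w (frame E j)) := by
    funext y
    rw [ricciCoord_apply, trace_eq_sum_coframe]; rfl
  have hc : ∑ i, coframe i (christoffel G y x (curvature G y v w (frame E i))) =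
      ∑ i, coframe i (curvature G y v w (christoffel G y x (frame E i))) := by
    have := LinearMap.trace_mul_comm ℝ (christoffel G y x : E →ₗ[ℝ] E)
      (curvature G y v w : E →ₗ[ℝ] E)
    rw [trace_eq_sum_coframe, trace_eq_sum_coframe] at this
    exact this
  rw [covDeriv, ← fderiv_apply_vec₂ hR, hf, fderiv_fun_sum fun j _ =>
    show DifferentiableAt ℝ (fun y => coframe j (curvature G y v w (frame E j))) y from
      (coframe j).differentiableAt.comp y (hG.differentiableAt_curvature_apply hy v w _)]
  have hd : ∀ j, fderiv ℝ (fun y => coframe j (curvature G y v w (frame E j))) y x =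
      coframe j (fderiv ℝ (fun y => curvature G y v w (frame E j)) y x) := fun j => by
    have := ((coframe j).hasFDerivAt.comp y
      (hG.differentiableAt_curvature_apply hy v w (frame E j)).hasFDerivAt).fderiv
    exact congrArg (fun A : E →L[ℝ] ℝ => A x) this
  simp only [FunLike.coe_sum, Finset.sum_apply, hd, ricciCoord_apply,
    trace_eq_sum_coframe, covCurvature, map_add, map_sub, Finset.sum_add_distrib,
    Finset.sum_sub_distrib, hc, ContinuousLinearMap.coe_coe]
  ring

theorem covDeriv_self (hy : y ∈ Ω) (x v w : E) : covDeriv G G y x v w = 0 := by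
  rw [covDeriv, hG.fderiv_eq hy]
  ring

end IsMetricOn

/-- Evaluation of bilinear forms at a pair of vectors. -/
def evalTwo (v w : E) : (E →L[ℝ] E →L[ℝ] ℝ) →L[ℝ] ℝ :=
  (ContinuousLinearMap.apply ℝ ℝ w).comp (ContinuousLinearMap.apply ℝ (E →L[ℝ] ℝ) v)

/-- Evaluation of trilinear forms at a triple of vectors. -/
def evalThree (u v w : E) : (E →L[ℝ] E →L[ℝ] E →L[ℝ] ℝ) →L[ℝ] ℝ :=
  (evalTwo v w).comp (ContinuousLinearMap.apply ℝ (E →L[ℝ] E →L[ℝ] ℝ) u)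

@[simp] theorem evalTwo_apply (v w : E) (T : E →L[ℝ] E →L[ℝ] ℝ) : evalTwo v w T = T v w := rfl

@[simp] theorem evalThree_apply (u v w : E) (T : E →L[ℝ] E →L[ℝ] E →L[ℝ] ℝ) :
    evalThree u v w T = T u v w := rfl

variable [FiniteDimensional ℝ E]

theorem contDiffOn_evalTwo {Ω : Set E} {a b : E → E} (ha : ContDiffOn ℝ ∞ a Ω)
    (hb : ContDiffOn ℝ ∞ b Ω) : ContDiffOn ℝ ∞ (fun y => evalTwo (a y) (b y)) Ω :=
  contDiffOn_clm_apply.2 fun _ => (contDiffOn_const.clm_apply ha).clm_apply hb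

theorem contDiffOn_evalThree {Ω : Set E} {a b c : E → E} (ha : ContDiffOn ℝ ∞ a Ω)
    (hb : ContDiffOn ℝ ∞ b Ω) (hc : ContDiffOn ℝ ∞ c Ω) :
    ContDiffOn ℝ ∞ (fun y => evalThree (a y) (b y) (c y)) Ω :=
  contDiffOn_clm_apply.2 fun _ =>
    ((contDiffOn_const.clm_apply ha).clm_apply hb).clm_apply hc

/-- The principal symbol of the operator `T ↦ 2 (div T)(v) - ∇_v (tr T)`. -/
def bianchiSymbol (G : E → E →L[ℝ] E →L[ℝ] ℝ) (v y : E) :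
    (E →L[ℝ] E →L[ℝ] E →L[ℝ] ℝ) →L[ℝ] ℝ :=
  ∑ j, ((2 : ℝ) • evalThree (frame E j) v (dualFrame (G y) j) -
    evalThree v (frame E j) (dualFrame (G y) j))

/-- The zeroth-order part of the operator `T ↦ 2 (div T)(v) - ∇_v (tr T)`. -/
def bianchiPotential (G : E → E →L[ℝ] E →L[ℝ] ℝ) (v y : E) : (E →L[ℝ] E →L[ℝ] ℝ) →L[ℝ] ℝ :=
  ∑ j, (evalTwo (christoffel G y v (frame E j)) (dualFrame (G y) j) +
      evalTwo (frame E j) (christoffel G y v (dualFrame (G y) j)) -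
    (2 : ℝ) • (evalTwo (christoffel G y (frame E j) v) (dualFrame (G y) j) +
      evalTwo v (christoffel G y (frame E j) (dualFrame (G y) j))))

theorem firstOrderOp_bianchi (G T : E → E →L[ℝ] E →L[ℝ] ℝ) (v y : E) :
    firstOrderOp (bianchiSymbol G v) (bianchiPotential G v) T y =
      2 * ∑ j, covDeriv G T y (frame E j) v (dualFrame (G y) j) -
        ∑ j, covDeriv G T y v (frame E j) (dualFrame (G y) j) := by
  simp only [firstOrderOp, bianchiSymbol, bianchiPotential, covDeriv, Finset.mul_sum,
    ← Finset.sum_sub_distrib, FunLike.coe_sum, Finset.sum_apply,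
    ← Finset.sum_add_distrib]
  refine Finset.sum_congr rfl fun j _ => ?_
  simp
  ring

namespace IsMetricOn

variable {G : E → E →L[ℝ] E →L[ℝ] ℝ} {Ω : Set E} (hG : IsMetricOn G Ω) {y : E}
include hG

theorem contDiffOn_dualFrame (j : Fin (Module.finrank ℝ E)) :
    ContDiffOn ℝ ∞ (fun y => dualFrame (G y) j) Ω :=
  hG.contDiffOn_inverse.clm_apply contDiffOn_const

theorem contDiffOn_bianchiSymbol (v : E) : ContDiffOn ℝ ∞ (bianchiSymbol G v) Ω :=
  ContDiffOn.sum fun j _ =>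
    ((contDiffOn_evalThree contDiffOn_const contDiffOn_const
      (hG.contDiffOn_dualFrame j)).const_smul _).sub
    (contDiffOn_evalThree contDiffOn_const contDiffOn_const (hG.contDiffOn_dualFrame j))

theorem contDiffOn_bianchiPotential (v : E) : ContDiffOn ℝ ∞ (bianchiPotential G v) Ω := by
  have hf := hG.contDiffOn_dualFrame
  have k : ∀ {a b : E → E}, ContDiffOn ℝ ∞ a Ω → ContDiffOn ℝ ∞ b Ω →
      ContDiffOn ℝ ∞ (fun y => christoffel G y (a y) (b y)) Ω := fun ha hb =>
    (hG.contDiffOn_christoffel.clm_apply ha).clm_apply hb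
  have c : ∀ v : E, ContDiffOn ℝ ∞ (fun _ : E => v) Ω := fun v => contDiffOn_const
  exact ContDiffOn.sum fun j _ =>
    ((contDiffOn_evalTwo (k (c _) (c _)) (hf j)).add
      (contDiffOn_evalTwo (c _) (k (c _) (hf j)))).sub
    (((contDiffOn_evalTwo (k (c _) (c _)) (hf j)).add
      (contDiffOn_evalTwo (c _) (k (c _) (hf j)))).const_smul _)

/-- The contracted Bianchi identity for the tensor `Ric - λ G`. -/
theorem contracted_bianchi (lam : ℝ) (hy : y ∈ Ω) (v : E) :
    firstOrderOp (bianchiSymbol G v) (bianchiPotential G v)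
      (fun y => ricciCoord G y - lam • G y) y = 0 := by
  have hR := hG.contDiffOn_ricciCoord.differentiableAt_of_mem hG.isOpen hy
  have h : ∀ x v w, covDeriv G (fun y => ricciCoord G y - lam • G y) y x v w =
      covDeriv G (ricciCoord G) y x v w := fun x v w => by
    have h0 := hG.covDeriv_self hy x v w
    rw [covDeriv, fderiv_fun_sub hR ((hG.differentiableAt hy).fun_const_smul lam),
      fderiv_fun_const_smul (hG.differentiableAt hy), covDeriv]
    rw [covDeriv] at h0
    simp only [sub_apply, smul_apply, smul_eq_mul]
    linear_combination - lam * h0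
  rw [firstOrderOp_bianchi]
  simp only [h, hG.covDeriv_ricciCoord hy]
  rw [sum_contracted_bianchi (hG.symm y hy) (covCurvature_antisymm G y) (hG.second_bianchi hy)
    (hG.covCurvature_skew hy), sub_self]

end IsMetricOn

end Bianchi

/-! ### Invariance under changes of coordinates -/

section Naturality

variable {E : Type*} [NormedAddCommGroup E] [NormedSpace ℝ E]

/-- The derivative of a bilinear field composed with a change of coordinates `φ`. -/
theorem fderiv_pullback_bilin {W : Type*} [NormedAddCommGroup W] [NormedSpace ℝ W]
    {φ : E → E} {B : E → E →L[ℝ] E →L[ℝ] W} {y : E} (hφ : DifferentiableAt ℝ φ y)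
    (hφ' : DifferentiableAt ℝ (fderiv ℝ φ) y) (hB : DifferentiableAt ℝ B (φ y)) (x u v : E) :
    fderiv ℝ (fun z => B (φ z) (fderiv ℝ φ z u) (fderiv ℝ φ z v)) y x =
      fderiv ℝ B (φ y) (fderiv ℝ φ y x) (fderiv ℝ φ y u) (fderiv ℝ φ y v) +
        B (φ y) (fderiv ℝ (fderiv ℝ φ) y x u) (fderiv ℝ φ y v) +
        B (φ y) (fderiv ℝ φ y u) (fderiv ℝ (fderiv ℝ φ) y x v) := by
  have c : ∀ u : E, DifferentiableAt ℝ (fun z => fderiv ℝ φ z u) y := fun u =>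
    hφ'.clm_apply (differentiableAt_const u)
  rw [fderiv_bilin_apply (f := fun z => B (φ z)) (hB.comp y hφ) (c u) (c v),
    fderiv_apply_vec hφ', fderiv_apply_vec hφ']
  have : fderiv ℝ (fun z => B (φ z)) y = (fderiv ℝ B (φ y)).comp (fderiv ℝ φ y) :=
    fderiv_comp y hB hφ
  rw [this]
  rfl

/-- The coordinate formula for the Lie derivative is invariant under changes of coordinates. -/
theorem lieDerivCoord_pullback {φ X X' : E → E} {T T' : E → E →L[ℝ] E →L[ℝ] ℝ} {O : Set E}
    (hO : IsOpen O) (hφ : ContDiffOn ℝ ∞ φ O) {y : E} (hy : y ∈ O)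
    (hX : DifferentiableAt ℝ X (φ y)) (hX' : DifferentiableAt ℝ X' y)
    (hT : DifferentiableAt ℝ T (φ y)) (hT' : DifferentiableAt ℝ T' y)
    (hXX' : ∀ z ∈ O, fderiv ℝ φ z (X' z) = X (φ z))
    (hTT' : ∀ z ∈ O, ∀ u v, T' z u v = T (φ z) (fderiv ℝ φ z u) (fderiv ℝ φ z v)) (u v : E) :
    lieDerivCoord X' T' y u v =
      lieDerivCoord X T (φ y) (fderiv ℝ φ y u) (fderiv ℝ φ y v) := by
  have d1 := hφ.differentiableAt_of_mem hO hy
  have d2 := (hφ.fderiv_infty hO).differentiableAt_of_mem hO hy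
  have hnhds := hO.mem_nhds hy
  have eX : ∀ w, fderiv ℝ (fderiv ℝ φ) y (X' y) w + fderiv ℝ φ y (fderiv ℝ X' y w) =
      fderiv ℝ X (φ y) (fderiv ℝ φ y w) := by
    intro w
    have e : (fun z => fderiv ℝ φ z (X' z)) =ᶠ[𝓝 y] fun z => X (φ z) :=
      Filter.eventuallyEq_of_mem hnhds hXX'
    have e' := congrArg (fun A : E →L[ℝ] E => A w) e.fderiv_eq
    have h2 : fderiv ℝ (fun z => X (φ z)) y = (fderiv ℝ X (φ y)).comp (fderiv ℝ φ y) :=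
      fderiv_comp y hX d1
    rw [fderiv_clm_apply d2 hX', h2] at e'
    simp only [add_apply, ContinuousLinearMap.comp_apply, ContinuousLinearMap.flip_apply] at e'
    rw [hφ.fderiv_fderiv_comm hO hy, ← e', add_comm]
  have eT : fderiv ℝ T' y (X' y) u v = fderiv ℝ T (φ y) (X (φ y)) (fderiv ℝ φ y u)
      (fderiv ℝ φ y v) + T (φ y) (fderiv ℝ (fderiv ℝ φ) y (X' y) u) (fderiv ℝ φ y v) +
        T (φ y) (fderiv ℝ φ y u) (fderiv ℝ (fderiv ℝ φ) y (X' y) v) := by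
    rw [← fderiv_apply_vec₂ hT', ← hXX' y hy, ← fderiv_pullback_bilin d1 d2 hT,
      (Filter.eventuallyEq_of_mem hnhds fun z hz => hTT' z hz u v).fderiv_eq]
  rw [lieDerivCoord_apply, lieDerivCoord_apply, eT, hTT' y hy, hTT' y hy, ← eX, ← eX]
  simp only [map_add, add_apply]
  ring

namespace IsMetricOn

variable [FiniteDimensional ℝ E] {φ : E → E} {G G' : E → E →L[ℝ] E →L[ℝ] ℝ} {O Ω : Set E}

omit [FiniteDimensional ℝ E] in
theorem fderiv_injective (hG' : IsMetricOn G' O)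
    (hGG' : ∀ z ∈ O, ∀ u v, G' z u v = G (φ z) (fderiv ℝ φ z u) (fderiv ℝ φ z v))
    {y : E} (hy : y ∈ O) : Function.Injective (fderiv ℝ φ y : E →ₗ[ℝ] E) := by
  rw [← LinearMap.ker_eq_bot, LinearMap.ker_eq_bot']
  intro v hv
  refine hG'.nondegenerate y hy v fun w => ?_
  rw [hGG' y hy]
  have hv' : fderiv ℝ φ y v = 0 := hv
  simp [hv']

/-- The transformation law of the Christoffel symbols. -/
theorem fderiv_christoffel_pullback (hG : IsMetricOn G Ω) (hG' : IsMetricOn G' O)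
    (hφ : ContDiffOn ℝ ∞ φ O) (hmaps : MapsTo φ O Ω)
    (hGG' : ∀ z ∈ O, ∀ u v, G' z u v = G (φ z) (fderiv ℝ φ z u) (fderiv ℝ φ z v))
    {y : E} (hy : y ∈ O) (u v : E) :
    fderiv ℝ φ y (christoffel G' y u v) =
      christoffel G (φ y) (fderiv ℝ φ y u) (fderiv ℝ φ y v) +
        fderiv ℝ (fderiv ℝ φ) y u v := by
  have hO := hG'.isOpen
  have hy' := hmaps hy
  have d1 := hφ.differentiableAt_of_mem hO hy
  have d2 := (hφ.fderiv_infty hO).differentiableAt_of_mem hO hy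
  have eG : ∀ x u v, fderiv ℝ G' y x u v = fderiv ℝ G (φ y) (fderiv ℝ φ y x) (fderiv ℝ φ y u)
      (fderiv ℝ φ y v) + G (φ y) (fderiv ℝ (fderiv ℝ φ) y x u) (fderiv ℝ φ y v) +
        G (φ y) (fderiv ℝ φ y u) (fderiv ℝ (fderiv ℝ φ) y x v) := fun x u v => by
    rw [← fderiv_apply_vec₂ (hG'.differentiableAt hy),
      ← fderiv_pullback_bilin d1 d2 (hG.differentiableAt hy'),
      (Filter.eventuallyEq_of_mem (hO.mem_nhds hy) fun z hz => hGG' z hz u v).fderiv_eq]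
  refine hG.eq_of_forall hy' fun w' => ?_
  obtain ⟨w, rfl⟩ := (LinearMap.injective_iff_surjective.1
    (fderiv_injective hG' hGG' hy)) w'
  change G (φ y) _ (fderiv ℝ φ y w) = G (φ y) _ (fderiv ℝ φ y w)
  rw [← hGG' y hy, hG'.metric_christoffel hy, map_add, add_apply, hG.metric_christoffel hy',
    christoffelFirst_apply, christoffelFirst_apply, eG, eG, eG,
    hφ.fderiv_fderiv_comm hO hy v u, hφ.fderiv_fderiv_comm hO hy w u,
    hφ.fderiv_fderiv_comm hO hy w v,
    hG.symm _ hy' (fderiv ℝ φ y u), hG.symm _ hy' (fderiv ℝ φ y v)]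
  ring

theorem fderiv_curvature_pullback (hG : IsMetricOn G Ω) (hG' : IsMetricOn G' O)
    (hφ : ContDiffOn ℝ ∞ φ O) (hmaps : MapsTo φ O Ω)
    (hGG' : ∀ z ∈ O, ∀ u v, G' z u v = G (φ z) (fderiv ℝ φ z u) (fderiv ℝ φ z v))
    {y : E} (hy : y ∈ O) (u v w : E) :
    fderiv ℝ φ y (curvature G' y v w u) =
      curvature G (φ y) (fderiv ℝ φ y v) (fderiv ℝ φ y w) (fderiv ℝ φ y u) := by
  have hO := hG'.isOpen
  have hy' := hmaps hy
  have d1 := hφ.differentiableAt_of_mem hO hy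
  have s2 := hφ.fderiv_infty hO
  have d2 := s2.differentiableAt_of_mem hO hy
  have d3 := (s2.fderiv_infty hO).differentiableAt_of_mem hO hy
  have dΓ := hG.differentiableAt_christoffel hy'
  have dΓ' := hG'.differentiableAt_christoffel hy
  have c : ∀ u : E, DifferentiableAt ℝ (fun _ : E => u) y := fun u => differentiableAt_const u
  have law := fun z (hz : z ∈ O) u v => fderiv_christoffel_pullback hG hG' hφ hmaps hGG' hz u v
  have key : ∀ x u v, fderiv ℝ φ y (fderiv ℝ (christoffel G') y x u v) =
      fderiv ℝ (christoffel G) (φ y) (fderiv ℝ φ y x) (fderiv ℝ φ y u) (fderiv ℝ φ y v) +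
        christoffel G (φ y) (fderiv ℝ (fderiv ℝ φ) y x u) (fderiv ℝ φ y v) +
        christoffel G (φ y) (fderiv ℝ φ y u) (fderiv ℝ (fderiv ℝ φ) y x v) +
        fderiv ℝ (fderiv ℝ (fderiv ℝ φ)) y x u v -
        fderiv ℝ (fderiv ℝ φ) y x (christoffel G' y u v) := by
    intro x u v
    have e : (fun z => fderiv ℝ φ z (christoffel G' z u v)) =ᶠ[𝓝 y] fun z =>
        christoffel G (φ z) (fderiv ℝ φ z u) (fderiv ℝ φ z v) + fderiv ℝ (fderiv ℝ φ) z u v :=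
      Filter.eventuallyEq_of_mem (hO.mem_nhds hy) fun z hz => law z hz u v
    have e' := congrArg (fun A : E →L[ℝ] E => A x) e.fderiv_eq
    have cu : ∀ u : E, DifferentiableAt ℝ (fun z => fderiv ℝ φ z u) y := fun u =>
      d2.clm_apply (c u)
    have dd : DifferentiableAt ℝ
        (fun z => christoffel G (φ z) (fderiv ℝ φ z u) (fderiv ℝ φ z v)) y :=
      (DifferentiableAt.clm_apply (dΓ.comp y d1) (cu u)).clm_apply (cu v)
    rw [fderiv_clm_apply d2 ((dΓ'.clm_apply (c u)).clm_apply (c v)),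
      fderiv_fun_add dd ((d3.clm_apply (c u)).clm_apply (c v))] at e'
    simp only [add_apply, ContinuousLinearMap.comp_apply, ContinuousLinearMap.flip_apply] at e'
    rw [fderiv_pullback_bilin d1 d2 dΓ, fderiv_apply_vec₂ dΓ', fderiv_apply_vec₂ d3] at e'
    rw [← e']
    abel
  simp only [curvature_apply, map_add, map_sub, key, law y hy]
  rw [s2.fderiv_fderiv_comm hO hy u v, hφ.fderiv_fderiv_comm hO hy u v]
  abel

/-- The coordinate formula for the Ricci tensor is invariant under changes of coordinates. -/
theorem ricciCoord_pullback (hG : IsMetricOn G Ω) (hG' : IsMetricOn G' O)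
    (hφ : ContDiffOn ℝ ∞ φ O) (hmaps : MapsTo φ O Ω)
    (hGG' : ∀ z ∈ O, ∀ u v, G' z u v = G (φ z) (fderiv ℝ φ z u) (fderiv ℝ φ z v))
    {y : E} (hy : y ∈ O) (v w : E) :
    ricciCoord G' y v w = ricciCoord G (φ y) (fderiv ℝ φ y v) (fderiv ℝ φ y w) := by
  let e : E ≃ₗ[ℝ] E := LinearEquiv.ofInjectiveEndo (fderiv ℝ φ y : E →ₗ[ℝ] E)
    (fderiv_injective hG' hGG' hy)
  rw [ricciCoord_apply, ricciCoord_apply, ← LinearMap.trace_conj' _ e]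
  congr 1
  ext u'
  obtain ⟨u, rfl⟩ := e.surjective u'
  rw [LinearEquiv.conj_apply_apply, LinearEquiv.symm_apply_apply]
  exact fderiv_curvature_pullback hG hG' hφ hmaps hGG' hy u v w

end IsMetricOn

end Naturality

/-! ### Traces with respect to metric hypersurface data -/

section HypersurfaceAlgebra

theorem trace_prod {V W : Type*} [AddCommGroup V] [Module ℝ V] [FiniteDimensional ℝ V]
    [AddCommGroup W] [Module ℝ W] [FiniteDimensional ℝ W] (K : V × W →ₗ[ℝ] V × W) :
    LinearMap.trace ℝ (V × W) K =
      LinearMap.trace ℝ V (LinearMap.fst ℝ V W ∘ₗ K ∘ₗ LinearMap.inl ℝ V W) +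
        LinearMap.trace ℝ W (LinearMap.snd ℝ V W ∘ₗ K ∘ₗ LinearMap.inr ℝ V W) := by
  rw [LinearMap.trace_comp_comm' (K ∘ₗ LinearMap.inl ℝ V W) (LinearMap.fst ℝ V W),
    LinearMap.trace_comp_comm' (K ∘ₗ LinearMap.inr ℝ V W) (LinearMap.snd ℝ V W), ← map_add]
  congr 1
  have h0 : K (0, 0) = 0 := map_zero K
  ext x <;> simp [h0]

theorem trace_real (f : ℝ →ₗ[ℝ] ℝ) : LinearMap.trace ℝ ℝ f = f 1 := by
  have : f = LinearMap.smulRight f (1 : ℝ) := by ext; simp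
  conv_lhs => rw [this]
  exact LinearMap.trace_smulRight f 1

variable {E : Type*} [NormedAddCommGroup E] [NormedSpace ℝ E] [FiniteDimensional ℝ E]
  {F : Type*} [NormedAddCommGroup F] [NormedSpace ℝ F] [FiniteDimensional ℝ F]

/-- A hyperplane `ι F` of `E` and a vector `X` transversal to it decompose `E`. -/
theorem exists_rigging_equiv (hdim : Module.finrank ℝ E = Module.finrank ℝ F + 1)
    {ι : F →L[ℝ] E} (hι : Function.Injective ι) {X : E} (hX : X ∉ range ι) :
    ∃ J : (F × ℝ) ≃ₗ[ℝ] E, ∀ p, J p = ι p.1 + p.2 • X := by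
  let J₀ : F × ℝ →ₗ[ℝ] E := (ι : F →ₗ[ℝ] E).coprod (LinearMap.toSpanSingleton ℝ E X)
  have hJ₀ : ∀ p, J₀ p = ι p.1 + p.2 • X := fun p => by simp [J₀]
  have hinj : Function.Injective J₀ := by
    rw [← LinearMap.ker_eq_bot, LinearMap.ker_eq_bot']
    rintro ⟨v, a⟩ h
    rw [hJ₀] at h
    have ha : a = 0 := by
      by_contra ha
      refine hX ⟨-(a⁻¹ • v), ?_⟩
      have h' : ι v = -(a • X) := eq_neg_of_add_eq_zero_left h
      rw [map_neg, map_smul, h', smul_neg, neg_neg, smul_smul, inv_mul_cancel₀ ha, one_smul]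
    subst ha
    simp only [zero_smul, add_zero] at h
    have : v = 0 := hι (by rw [h, map_zero])
    rw [this]; rfl
  exact ⟨LinearEquiv.ofInjectiveOfFinrankEq J₀ hinj (by simp [hdim]), hJ₀⟩

/-- Let `S` be a symmetric bilinear form on `E` with `2 S(v, grad α) = α(v) tr S` for the conormal
`α` of a null hyperplane. Then the restriction of `S` to the hyperplane is annihilated by `n` and
has vanishing `P`-trace. The reason is that `n` is the metric dual of `α`, so that `S(n, ·)`
vanishes on the hyperplane and `tr S = 2 S(n, X)`, whereas `tr S = tr_P S + 2 S(n, X)`. -/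
theorem nVec_and_trP_eq_zero (hdim : Module.finrank ℝ E = Module.finrank ℝ F + 1)
    {ι : F →L[ℝ] E} (hι : Function.Injective ι) {X : E} (hX : X ∉ range ι)
    {G : E →L[ℝ] E →L[ℝ] ℝ} (hG : ∀ v, (∀ w, G v w = 0) → v = 0) (hGs : ∀ v w, G v w = G w v)
    {γ : F →L[ℝ] F →L[ℝ] ℝ} {l : F →L[ℝ] ℝ} {l₂ : ℝ} (hγ : ∀ u v, γ u v = G (ι u) (ι v))
    (hl : ∀ v, l v = G X (ι v)) (hl₂ : l₂ = G X X)
    (hnull : ∃ v, v ≠ 0 ∧ ∀ w, γ v w = 0)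
    {α : E →L[ℝ] ℝ} (hαι : ∀ v, α (ι v) = 0) (hαX : α X = 1)
    {S : E →L[ℝ] E →L[ℝ] ℝ} (hSs : ∀ v w, S v w = S w v)
    (hS : ∀ v, 2 * ∑ j, α (frame E j) * S v (dualFrame G j) =
      α v * ∑ j, S (frame E j) (dualFrame G j))
    {B : F →L[ℝ] F →L[ℝ] ℝ} (hB : ∀ u v, B u v = S (ι u) (ι v)) :
    (∀ w, B (nVec γ l l₂) w = 0) ∧ trP γ l l₂ B = 0 := by
  have hGi := isInvertible_of_nondegenerate hG
  obtain ⟨J, hJ⟩ := exists_rigging_equiv hdim hι hX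
  have hA : ∀ p q, ambientForm γ l l₂ p q = G (J p) (J q) := by
    rintro ⟨w, a⟩ ⟨v, b⟩
    rw [ambientForm_apply, hJ, hJ, hγ, hl, hl, hl₂]
    simp only [map_add, map_smul, add_apply, smul_apply, smul_eq_mul]
    rw [hGs X (ι w)]
    ring
  have hAi : (ambientForm γ l l₂).IsInvertible := isInvertible_of_nondegenerate fun p hp => by
    have : J p = 0 := hG _ fun w => by
      obtain ⟨q, rfl⟩ := J.surjective w
      rw [← hA, hp]
    exact J.map_eq_zero_iff.1 this
  have hsharp : ∀ φ q, ambientForm γ l l₂ (sharp γ l l₂ φ) q = φ q := fun φ q => by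
    rw [sharp, apply_inverse_apply hAi]
  have hαJ : ∀ q, α (J q) = q.2 := fun q => by simp [hJ, hαι, hαX]
  -- the metric dual `ν` of the conormal
  set ν : E := ∑ j, α (frame E j) • dualFrame G j with hν
  have hGν : ∀ v, G ν v = α v := fun v => by
    conv_rhs => rw [← sum_coframe_smul v]
    rw [hGs, hν, map_sum, map_sum]
    refine Finset.sum_congr rfl fun j _ => ?_
    rw [map_smul, map_smul, apply_dualFrame hGi hGs, smul_eq_mul, smul_eq_mul, mul_comm]
  have hνS : ∀ v, 2 * S v ν = α v * ∑ j, S (frame E j) (dualFrame G j) := fun v => by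
    rw [← hS, hν, map_sum]
    simp
  -- a vector `v₀` in the kernel of `γ` is a nonzero multiple of `ν`, so `ν` is tangent
  have hαν : α ν = 0 := by
    obtain ⟨v₀, hv₀, hv₀'⟩ := hnull
    have h1 : ι v₀ = G (ι v₀) X • ν := by
      rw [← sub_eq_zero]
      refine hG _ fun w => ?_
      obtain ⟨q, rfl⟩ := J.surjective w
      rw [map_sub, map_smul, sub_apply, smul_apply, hGν, hαJ, hJ, map_add, map_smul, ← hγ, hv₀']
      simp [mul_comm]
    have h2 : G (ι v₀) X ≠ 0 := fun h => hv₀ (hι (by rw [h1, h, zero_smul, map_zero]))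
    have h3 := hαι v₀
    rw [h1, map_smul, smul_eq_mul] at h3
    exact (mul_eq_zero.1 h3).resolve_left h2
  have hJn : J (sharp γ l l₂ (ContinuousLinearMap.snd ℝ F ℝ)) = ν := by
    rw [← sub_eq_zero]
    refine hG _ fun w => ?_
    obtain ⟨q, rfl⟩ := J.surjective w
    rw [map_sub, sub_apply, ← hA, hsharp, hGν, hαJ]
    simp
  have hn2 : (sharp γ l l₂ (ContinuousLinearMap.snd ℝ F ℝ)).2 = 0 := by
    rw [← hαJ, hJn, hαν]
  have hιn : ι (nVec γ l l₂) = ν := by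
    rw [← hJn, hJ, hn2, zero_smul, add_zero]
    rfl
  refine ⟨fun w => ?_, ?_⟩
  · have := hνS (ι w)
    rw [hαι, zero_mul] at this
    rw [hB, hιn, hSs]
    linarith
  · -- the pullback of `S` to `F × ℝ`
    set Jc : F × ℝ →L[ℝ] E := (J.toContinuousLinearEquiv : F × ℝ →L[ℝ] E) with hJc
    have hJc' : ∀ p, Jc p = J p := fun p => rfl
    set S' : F × ℝ →L[ℝ] F × ℝ →L[ℝ] ℝ :=
      (ContinuousLinearMap.precomp ℝ Jc).comp (S.comp Jc) with hS'
    have hS'a : ∀ p q, S' p q = S (J p) (J q) := fun p q => rfl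
    have htr : LinearMap.trace ℝ (F × ℝ)
        (((sharp γ l l₂).comp S' : F × ℝ →L[ℝ] F × ℝ) : F × ℝ →ₗ[ℝ] F × ℝ) =
          ∑ j, S (frame E j) (dualFrame G j) := by
      rw [← trace_inverse_comp hGi hGs, ← LinearMap.trace_conj' _ J]
      congr 1
      ext e
      obtain ⟨p, rfl⟩ := J.surjective e
      rw [LinearEquiv.conj_apply_apply, LinearEquiv.symm_apply_apply]
      rw [← sub_eq_zero]
      refine hG _ fun w => ?_
      obtain ⟨q, rfl⟩ := J.surjective w
      simp only [ContinuousLinearMap.coe_coe, ContinuousLinearMap.comp_apply]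
      rw [map_sub, sub_apply, ← hA, hsharp, apply_inverse_apply hGi, hS'a, sub_self]
    -- the trace over `F × ℝ` is split into its two diagonal blocks
    have hfst : LinearMap.fst ℝ F ℝ ∘ₗ
        (((sharp γ l l₂).comp S' : F × ℝ →L[ℝ] F × ℝ) : F × ℝ →ₗ[ℝ] F × ℝ) ∘ₗ
          LinearMap.inl ℝ F ℝ = (((pMap γ l l₂).comp B : F →L[ℝ] F) : F →ₗ[ℝ] F) +
            LinearMap.smulRight ((S.flip X).comp ι : F →ₗ[ℝ] ℝ) (nVec γ l l₂) := by
      ext v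
      have hsplit : S' (v, 0) = ContinuousLinearMap.precomp ℝ (ContinuousLinearMap.fst ℝ F ℝ)
          (B v) + S (ι v) X • ContinuousLinearMap.snd ℝ F ℝ := by
        refine ContinuousLinearMap.ext fun q => ?_
        rw [hS'a, hJ, hJ]
        simp [hB, mul_comm]
      simp [hsplit, pMap, nVec]
    have hsnd : LinearMap.snd ℝ F ℝ
        ((((sharp γ l l₂).comp S' : F × ℝ →L[ℝ] F × ℝ) : F × ℝ →ₗ[ℝ] F × ℝ)
          (LinearMap.inr ℝ F ℝ 1)) = S X ν := by
      have h1 := hsharp (ContinuousLinearMap.snd ℝ F ℝ) (sharp γ l l₂ (S' (0, 1)))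
      rw [hA, hGs, ← hA, hsharp, hS'a, hJn, hJ] at h1
      simpa using h1.symm
    have hX2 := hνS X
    rw [hαX, one_mul] at hX2
    rw [trace_prod, hfst, trace_real, map_add, LinearMap.trace_smulRight] at htr
    have htr' : trP γ l l₂ B + S ν X + S X ν = ∑ j, S (frame E j) (dualFrame G j) := by
      rw [← htr, LinearMap.comp_apply, LinearMap.comp_apply, hsnd, ← hιn]
      rfl
    rw [hSs ν X] at htr'
    linarith

omit [FiniteDimensional ℝ F] in
theorem trP_sub_smul (γ : F →L[ℝ] F →L[ℝ] ℝ) (l : F →L[ℝ] ℝ) (l₂ : ℝ) (B B' : F →L[ℝ] F →L[ℝ] ℝ)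
    (c : ℝ) : trP γ l l₂ (B - c • B') = trP γ l l₂ B - c * trP γ l l₂ B' := by
  rw [trP, trP, trP, ← smul_eq_mul, ← map_smul, ← map_sub]
  congr 1
  ext v
  simp

end HypersurfaceAlgebra

/-! ### The leading transversal order of the contracted Bianchi identity -/

section Transversal

variable {E : Type*} [NormedAddCommGroup E] [NormedSpace ℝ E]

/-- The zeroth-order part `T ↦ T(DX ·, ·) + T(·, DX ·)` of the Lie derivative along `X`. -/
def liePotential (X : E → E) (y : E) : (E →L[ℝ] E →L[ℝ] ℝ) →L[ℝ] (E →L[ℝ] E →L[ℝ] ℝ) :=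
  let flip : (E →L[ℝ] E →L[ℝ] ℝ) →L[ℝ] (E →L[ℝ] E →L[ℝ] ℝ) :=
    (ContinuousLinearMap.flipₗᵢ ℝ E E ℝ).toContinuousLinearEquiv.toContinuousLinearMap
  let B : (E →L[ℝ] E →L[ℝ] ℝ) →L[ℝ] (E →L[ℝ] E →L[ℝ] ℝ) :=
    (ContinuousLinearMap.compL ℝ E E (E →L[ℝ] ℝ)).flip (fderiv ℝ X y)
  B + flip.comp (B.comp flip)

theorem lieDerivCoord_eq_derivAlong (X : E → E) :
    lieDerivCoord X = derivAlong X (liePotential X) := by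
  funext T y
  ext u v
  simp [lieDerivCoord_apply, derivAlong, liePotential, add_assoc]

theorem lieDerivCoord_symm {X : E → E} {T : E → E →L[ℝ] E →L[ℝ] ℝ} {Ω : Set E} (hΩ : IsOpen Ω)
    (hT : ContDiffOn ℝ ∞ T Ω) (hs : ∀ y ∈ Ω, ∀ v w, T y v w = T y w v) :
    ∀ y ∈ Ω, ∀ v w, lieDerivCoord X T y v w = lieDerivCoord X T y w v := by
  intro y hy v w
  have hd := hT.differentiableAt_of_mem hΩ hy
  rw [lieDerivCoord_apply, lieDerivCoord_apply, ← fderiv_apply_vec₂ hd, ← fderiv_apply_vec₂ hd,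
    (Filter.eventuallyEq_of_mem (hΩ.mem_nhds hy) fun z hz => hs z hz v w).fderiv_eq,
    hs y hy _ w, hs y hy v]
  ring

variable [FiniteDimensional ℝ E]

theorem contDiffOn_liePotential {X : E → E} {Ω : Set E} (hΩ : IsOpen Ω)
    (hX : ContDiffOn ℝ ∞ X Ω) : ContDiffOn ℝ ∞ (liePotential X) Ω := by
  have h := hX.fderiv_infty hΩ
  refine contDiffOn_clm_apply.2 fun T => contDiffOn_clm_apply.2 fun u =>
    contDiffOn_clm_apply.2 fun v => ?_
  have e : ∀ y, liePotential X y T u v = T (fderiv ℝ X y u) v + T u (fderiv ℝ X y v) := fun y => by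
    simp [liePotential]
  simp only [e]
  have k : ∀ u : E, ContDiffOn ℝ ∞ (fun y => fderiv ℝ X y u) Ω := fun u =>
    h.clm_apply contDiffOn_const
  exact ((contDiffOn_const.clm_apply (k u)).clm_apply contDiffOn_const).add
    (contDiffOn_const.clm_apply (k v))

theorem contDiffOn_iterate_lieDerivCoord {X : E → E} {T : E → E →L[ℝ] E →L[ℝ] ℝ} {Ω : Set E}
    (hΩ : IsOpen Ω) (hX : ContDiffOn ℝ ∞ X Ω) (hT : ContDiffOn ℝ ∞ T Ω) (k : ℕ) :
    ContDiffOn ℝ ∞ ((lieDerivCoord X)^[k] T) Ω := by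
  rw [lieDerivCoord_eq_derivAlong]
  exact contDiffOn_iterate_derivAlong hΩ hX (contDiffOn_liePotential hΩ hX) hT k

theorem iterate_lieDerivCoord_symm {X : E → E} {T : E → E →L[ℝ] E →L[ℝ] ℝ} {Ω : Set E}
    (hΩ : IsOpen Ω) (hX : ContDiffOn ℝ ∞ X Ω) (hT : ContDiffOn ℝ ∞ T Ω)
    (hs : ∀ y ∈ Ω, ∀ v w, T y v w = T y w v) (k : ℕ) :
    ∀ y ∈ Ω, ∀ v w, (lieDerivCoord X)^[k] T y v w = (lieDerivCoord X)^[k] T y w v := by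
  induction k with
  | zero => exact hs
  | succ k ih =>
    rw [Function.iterate_succ_apply']
    exact lieDerivCoord_symm hΩ (contDiffOn_iterate_lieDerivCoord hΩ hX hT k) ih

/-- If `Ric - λ G` and its Lie derivatives of order less than `m` vanish on `H`, then its `m`-th Lie
derivative `S` satisfies `2 S(v, grad α) = α(v) tr S` at a point of `H` with conormal `α`: this is
the leading transversal order of the contracted Bianchi identity. -/
theorem IsMetricOn.bianchiSymbol_iterate_lieDerivCoord {G : E → E →L[ℝ] E →L[ℝ] ℝ} {Ω : Set E}
    (hG : IsMetricOn G Ω) {X : E → E} (hX : ContDiffOn ℝ ∞ X Ω) {H : Set E} (hHΩ : H ⊆ Ω)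
    {y₀ : E} (hy₀ : y₀ ∈ H) {α : E →L[ℝ] ℝ}
    (hH : ∀ f : E → E →L[ℝ] E →L[ℝ] ℝ, DifferentiableAt ℝ f y₀ → (∀ z ∈ H, f z = 0) →
      fderiv ℝ f y₀ = α.smulRight (fderiv ℝ f y₀ (X y₀)))
    (lam : ℝ) {m : ℕ} (hm : 1 ≤ m)
    (hRic : ∀ i < m, ∀ z ∈ H, (lieDerivCoord X)^[i] (ricciCoord G) z =
      lam • (lieDerivCoord X)^[i] G z) (v : E) :
    bianchiSymbol G v y₀ (α.smulRight ((lieDerivCoord X)^[m] (ricciCoord G) y₀ -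
      lam • (lieDerivCoord X)^[m] G y₀)) = 0 := by
  have hΩ := hG.isOpen
  have hA := contDiffOn_liePotential hΩ hX
  have hR := hG.contDiffOn_ricciCoord
  have hT : ContDiffOn ℝ ∞ (fun y => ricciCoord G y - lam • G y) Ω :=
    hR.sub (hG.contDiffOn.const_smul lam)
  have hit : ∀ i, ∀ z ∈ Ω, (lieDerivCoord X)^[i] (fun y => ricciCoord G y - lam • G y) z =
      (lieDerivCoord X)^[i] (ricciCoord G) z - lam • (lieDerivCoord X)^[i] G z := fun i z hz => by
    rw [lieDerivCoord_eq_derivAlong]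
    exact iterate_derivAlong_sub_smul hΩ hX hA hR hG.contDiffOn lam i hz
  obtain ⟨k, rfl⟩ : ∃ k, m = k + 1 := ⟨m - 1, by lia⟩
  have key := (iterate_derivAlong_firstOrderOp hΩ hX hA (hHΩ hy₀) hy₀ hH k
    (hG.contDiffOn_bianchiSymbol v) (hG.contDiffOn_bianchiPotential v) hT
    (fun i hi z hz => by
      rw [← lieDerivCoord_eq_derivAlong, hit i z (hHΩ hz), hRic i (by lia) z hz, sub_self])).2
  rw [← lieDerivCoord_eq_derivAlong, hit _ _ (hHΩ hy₀)] at key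
  rw [← key]
  have hzero : EqOn (firstOrderOp (bianchiSymbol G v) (bianchiPotential G v)
      (fun y => ricciCoord G y - lam • G y)) (fun _ => 0) Ω := fun y hy =>
    hG.contracted_bianchi lam hy v
  rw [eqOn_iterate_derivAlong hΩ hzero k (hHΩ hy₀)]
  have : derivAlong X (0 : E → ℝ →L[ℝ] ℝ) (fun _ => (0 : ℝ)) = fun _ => 0 := by
    funext y
    simp [derivAlong]
  rw [Function.iterate_fixed this]

end Transversal

/-! ### Tensor fields on a manifold in the preferred charts -/

section Charts

variable {E : Type*} [NormedAddCommGroup E] [NormedSpace ℝ E]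
  {M : Type*} [TopologicalSpace M] [ChartedSpace E M]

/-- The derivative of the inverse of the preferred chart at `x₀`, as an endomorphism of the model
space. -/
def chartSymmDeriv (x₀ : M) (y : E) : E →L[ℝ] E :=
  mfderiv 𝓘(ℝ, E) 𝓘(ℝ, E) (extChartAt 𝓘(ℝ, E) x₀).symm y

/-- The derivative of the preferred chart at `x₀`, as an endomorphism of the model space. -/
def chartDeriv (x₀ x : M) : E →L[ℝ] E :=
  mfderiv 𝓘(ℝ, E) 𝓘(ℝ, E) (extChartAt 𝓘(ℝ, E) x₀) x

/-- The transition map from the preferred chart at `x₀` to the preferred chart at `x₁`. -/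
def transition (x₀ x₁ : M) : E → E := extChartAt 𝓘(ℝ, E) x₁ ∘ (extChartAt 𝓘(ℝ, E) x₀).symm

/-- The image of `U` in the preferred chart at `x₀`. -/
def chartDomain (x₀ : M) (U : Set M) : Set E :=
  (extChartAt 𝓘(ℝ, E) x₀).target ∩ (extChartAt 𝓘(ℝ, E) x₀).symm ⁻¹' U

theorem isOpen_chartDomain (x₀ : M) {U : Set M} (hU : IsOpen U) :
    IsOpen (chartDomain (E := E) x₀ U) :=
  (continuousOn_extChartAt_symm x₀).isOpen_inter_preimage (isOpen_extChartAt_target x₀) hU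

variable [IsManifold 𝓘(ℝ, E) ∞ M]

theorem mdifferentiableAt_chart_symm {x₀ : M} {y : E}
    (hy : y ∈ (extChartAt 𝓘(ℝ, E) x₀).target) :
    MDifferentiableAt 𝓘(ℝ, E) 𝓘(ℝ, E) (extChartAt 𝓘(ℝ, E) x₀).symm y := by
  have := mdifferentiableWithinAt_extChartAt_symm hy
  rwa [modelWithCornersSelf_coe, range_id, mdifferentiableWithinAt_univ] at this

theorem chartDeriv_chartSymmDeriv {x₀ : M} {y : E} (hy : y ∈ (extChartAt 𝓘(ℝ, E) x₀).target)
    (v : E) : chartDeriv x₀ ((extChartAt 𝓘(ℝ, E) x₀).symm y) (chartSymmDeriv x₀ y v) = v := by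
  have := mfderiv_extChartAt_comp_mfderivWithin_extChartAt_symm hy
  simp only [modelWithCornersSelf_coe, range_id, mfderivWithin_univ] at this
  exact congrArg (fun A : E →L[ℝ] E => A v) this

theorem chartSymmDeriv_chartDeriv {x₀ : M} {y : E} (hy : y ∈ (extChartAt 𝓘(ℝ, E) x₀).target)
    (v : E) : chartSymmDeriv x₀ y (chartDeriv x₀ ((extChartAt 𝓘(ℝ, E) x₀).symm y) v) = v := by
  have := mfderivWithin_extChartAt_symm_comp_mfderiv_extChartAt hy
  simp only [modelWithCornersSelf_coe, range_id, mfderivWithin_univ] at this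
  exact congrArg (fun A : E →L[ℝ] E => A v) this

theorem isInvertible_chartSymmDeriv {x₀ : M} {y : E}
    (hy : y ∈ (extChartAt 𝓘(ℝ, E) x₀).target) : (chartSymmDeriv x₀ y).IsInvertible :=
  ContinuousLinearMap.IsInvertible.of_inverse
    (ContinuousLinearMap.ext fun v => chartSymmDeriv_chartDeriv hy v)
    (ContinuousLinearMap.ext fun v => chartDeriv_chartSymmDeriv hy v)

omit [IsManifold 𝓘(ℝ, E) ∞ M] in
theorem tensorInChart_eq (T : TwoTensorField E M) (x₀ : M) (y u v : E) :
    tensorInChart T x₀ y u v =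
      T ((extChartAt 𝓘(ℝ, E) x₀).symm y) (chartSymmDeriv x₀ y u) (chartSymmDeriv x₀ y v) := rfl

theorem chartSymmDeriv_vectorInChart (X : ∀ x : M, TangentSpace 𝓘(ℝ, E) x) {x₀ : M} {y : E}
    (hy : y ∈ (extChartAt 𝓘(ℝ, E) x₀).target) :
    chartSymmDeriv x₀ y (vectorInChart X x₀ y) = X ((extChartAt 𝓘(ℝ, E) x₀).symm y) :=
  apply_inverse_apply (isInvertible_chartSymmDeriv hy) _

theorem contDiffOn_transition (x₀ x₁ : M) :
    ContDiffOn ℝ ∞ (transition (E := E) x₀ x₁)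
      (chartDomain x₀ (extChartAt 𝓘(ℝ, E) x₁).source) := by
  have := contDiffOn_ext_coord_change (I := 𝓘(ℝ, E)) (n := ∞) x₁ x₀
  refine this.mono ?_
  intro y hy
  simpa [chartDomain] using hy

theorem fderiv_transition {x₀ x₁ : M} {y : E}
    (hy : y ∈ chartDomain x₀ (extChartAt 𝓘(ℝ, E) x₁).source) (u : E) :
    fderiv ℝ (transition x₀ x₁) y u =
      chartDeriv x₁ ((extChartAt 𝓘(ℝ, E) x₀).symm y) (chartSymmDeriv x₀ y u) := by
  have h1 : MDifferentiableAt 𝓘(ℝ, E) 𝓘(ℝ, E) (extChartAt 𝓘(ℝ, E) x₁)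
      ((extChartAt 𝓘(ℝ, E) x₀).symm y) :=
    mdifferentiableAt_extChartAt (by simpa using hy.2)
  have := mfderiv_comp y h1 (mdifferentiableAt_chart_symm hy.1)
  rw [← mfderiv_eq_fderiv, transition, this]
  rfl

omit [IsManifold 𝓘(ℝ, E) ∞ M] in
theorem transition_mem {x₀ x₁ : M} {U : Set M} {y : E}
    (hy : y ∈ chartDomain x₀ (extChartAt 𝓘(ℝ, E) x₁).source)
    (hyU : (extChartAt 𝓘(ℝ, E) x₀).symm y ∈ U) : transition x₀ x₁ y ∈ chartDomain x₁ U := by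
  refine ⟨(extChartAt 𝓘(ℝ, E) x₁).map_source hy.2, ?_⟩
  rw [mem_preimage, transition, Function.comp_apply, (extChartAt 𝓘(ℝ, E) x₁).left_inv hy.2]
  exact hyU

omit [IsManifold 𝓘(ℝ, E) ∞ M] in
theorem chart_symm_transition {x₀ x₁ : M} {y : E}
    (hy : y ∈ chartDomain x₀ (extChartAt 𝓘(ℝ, E) x₁).source) :
    (extChartAt 𝓘(ℝ, E) x₁).symm (transition x₀ x₁ y) = (extChartAt 𝓘(ℝ, E) x₀).symm y :=
  (extChartAt 𝓘(ℝ, E) x₁).left_inv hy.2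

theorem chartSymmDeriv_transition {x₀ x₁ : M} {y : E}
    (hy : y ∈ chartDomain x₀ (extChartAt 𝓘(ℝ, E) x₁).source) (u : E) :
    chartSymmDeriv x₁ (transition x₀ x₁ y) (fderiv ℝ (transition x₀ x₁) y u) =
      chartSymmDeriv x₀ y u := by
  rw [fderiv_transition hy, ← chart_symm_transition hy]
  exact chartSymmDeriv_chartDeriv (x₀ := x₁) (y := transition x₀ x₁ y)
    ((extChartAt 𝓘(ℝ, E) x₁).map_source hy.2) _

/-- The coordinate expressions of a tensor field in two charts. -/
theorem tensorInChart_transition (T : TwoTensorField E M) {x₀ x₁ : M} {y : E}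
    (hy : y ∈ chartDomain x₀ (extChartAt 𝓘(ℝ, E) x₁).source) (u v : E) :
    tensorInChart T x₀ y u v = tensorInChart T x₁ (transition x₀ x₁ y)
      (fderiv ℝ (transition x₀ x₁) y u) (fderiv ℝ (transition x₀ x₁) y v) := by
  rw [tensorInChart_eq, tensorInChart_eq, chartSymmDeriv_transition hy,
    chartSymmDeriv_transition hy, chart_symm_transition hy]

/-- The coordinate expressions of a vector field in two charts. -/
theorem vectorInChart_transition (X : ∀ x : M, TangentSpace 𝓘(ℝ, E) x) {x₀ x₁ : M} {y : E}
    (hy : y ∈ chartDomain x₀ (extChartAt 𝓘(ℝ, E) x₁).source) :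
    fderiv ℝ (transition x₀ x₁) y (vectorInChart X x₀ y) =
      vectorInChart X x₁ (transition x₀ x₁ y) := by
  have hy' := (extChartAt 𝓘(ℝ, E) x₁).map_source hy.2
  have hinj : ∀ u v, chartSymmDeriv x₁ (transition x₀ x₁ y) u =
      chartSymmDeriv x₁ (transition x₀ x₁ y) v → u = v := fun u v h => by
    rw [← inverse_apply_apply (isInvertible_chartSymmDeriv hy') u]
    exact (congrArg _ h).trans (inverse_apply_apply (isInvertible_chartSymmDeriv hy') v)
  apply hinj
  rw [chartSymmDeriv_transition hy, chartSymmDeriv_vectorInChart X hy.1]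
  refine Eq.trans ?_ (chartSymmDeriv_vectorInChart X hy').symm
  exact congrArg (fun p => (X p : E)) (chart_symm_transition hy).symm

/-- The coordinate expressions of the tensor field `T` are smooth on `U`. -/
def IsSmoothInCharts (T : TwoTensorField E M) (U : Set M) : Prop :=
  ∀ x₀ : M, ContDiffOn ℝ ∞ (tensorInChart T x₀) (chartDomain x₀ U)

omit [IsManifold 𝓘(ℝ, E) ∞ M] in
theorem mem_chartDomain_source_self {x₀ : M} {y : E}
    (hy : y ∈ (extChartAt 𝓘(ℝ, E) x₀).target) :
    y ∈ chartDomain x₀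
      (extChartAt 𝓘(ℝ, E) ((extChartAt 𝓘(ℝ, E) x₀).symm y)).source :=
  ⟨hy, mem_extChartAt_source _⟩

theorem tensorInChart_lieDeriv {X : ∀ x : M, TangentSpace 𝓘(ℝ, E) x} {T : TwoTensorField E M}
    {U : Set M} (hU : IsOpen U)
    (hX : ∀ x₀ : M, ContDiffOn ℝ ∞ (vectorInChart X x₀) (chartDomain x₀ U))
    (hT : IsSmoothInCharts T U) (x₀ : M) :
    EqOn (tensorInChart (lieDeriv X T) x₀)
      (lieDerivCoord (vectorInChart X x₀) (tensorInChart T x₀)) (chartDomain x₀ U) := by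
  intro y hy
  set p := (extChartAt 𝓘(ℝ, E) x₀).symm y with hp
  have hO := isOpen_chartDomain (E := E) x₀ (isOpen_extChartAt_source (I := 𝓘(ℝ, E)) p)
  have hyO := mem_chartDomain_source_self hy.1
  have hy' : transition x₀ p y ∈ chartDomain p U := transition_mem hyO hy.2
  ext u v
  have key := lieDerivCoord_pullback hO (contDiffOn_transition x₀ p) hyO
    ((hX p).differentiableAt_of_mem (isOpen_chartDomain p hU) hy')
    ((hX x₀).differentiableAt_of_mem (isOpen_chartDomain x₀ hU) hy)
    ((hT p).differentiableAt_of_mem (isOpen_chartDomain p hU) hy')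
    ((hT x₀).differentiableAt_of_mem (isOpen_chartDomain x₀ hU) hy)
    (fun z hz => vectorInChart_transition X hz)
    (fun z hz u v => tensorInChart_transition T hz u v) u v
  rw [key, fderiv_transition hyO, fderiv_transition hyO]
  rfl

end Charts

section Smoothness

variable {E : Type*} [NormedAddCommGroup E] [NormedSpace ℝ E] [FiniteDimensional ℝ E]
  {M : Type*} [TopologicalSpace M] [ChartedSpace E M] [IsManifold 𝓘(ℝ, E) ∞ M]

omit [FiniteDimensional ℝ E] in
theorem contMDiffAt_chart_symm {x₀ : M} {y : E} (hy : y ∈ (extChartAt 𝓘(ℝ, E) x₀).target) :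
    ContMDiffAt 𝓘(ℝ, E) 𝓘(ℝ, E) ∞ (extChartAt 𝓘(ℝ, E) x₀).symm y :=
  (contMDiffOn_extChartAt_symm x₀).contMDiffAt ((isOpen_extChartAt_target x₀).mem_nhds hy)

theorem contDiffOn_vectorInChart {X : ∀ x : M, TangentSpace 𝓘(ℝ, E) x} {U : Set M}
    (hU : IsOpen U) (hX : ContMDiffOn 𝓘(ℝ, E) 𝓘(ℝ, E).tangent ∞
      (fun x => (⟨x, X x⟩ : TangentBundle 𝓘(ℝ, E) M)) U) (x₀ : M) :
    ContDiffOn ℝ ∞ (vectorInChart X x₀) (chartDomain x₀ U) := by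
  intro y hy
  have h1 : ContMDiffAt 𝓘(ℝ, E) 𝓘(ℝ, E).tangent ∞
      (fun x => (⟨x, X x⟩ : TangentBundle 𝓘(ℝ, E) M)) ((extChartAt 𝓘(ℝ, E) x₀).symm y) :=
    hX.contMDiffAt (hU.mem_nhds hy.2)
  have hi : (mfderiv 𝓘(ℝ, E) 𝓘(ℝ, E) (extChartAt 𝓘(ℝ, E) x₀).symm y).IsInvertible :=
    isInvertible_chartSymmDeriv (E := E) hy.1
  have h2 := ContMDiffAt.mpullback_vectorField_preimage h1 (contMDiffAt_chart_symm hy.1) hi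
    (by simp)
  exact (contMDiffAt_vectorSpace_iff_contDiffAt.1 h2).contDiffWithinAt

/-- The coordinate vector fields of a chart are smooth. -/
theorem contMDiffAt_chartSymmDeriv {x₀ : M} {y : E} (hy : y ∈ (extChartAt 𝓘(ℝ, E) x₀).target)
    (u : E) : ContMDiffAt 𝓘(ℝ, E) 𝓘(ℝ, E).tangent ∞
      (fun z => (⟨(extChartAt 𝓘(ℝ, E) x₀).symm z, chartSymmDeriv x₀ z u⟩ :
        TangentBundle 𝓘(ℝ, E) M)) y := by
  have hs : ∀ z ∈ (extChartAt 𝓘(ℝ, E) x₀).target,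
      (extChartAt 𝓘(ℝ, E) x₀).symm z ∈ (extChartAt 𝓘(ℝ, E) x₀).source := fun z hz =>
    (extChartAt 𝓘(ℝ, E) x₀).map_target hz
  have hc : ContMDiffAt 𝓘(ℝ, E) 𝓘(ℝ, E).tangent ∞
      (fun z => (⟨z, u⟩ : TangentBundle 𝓘(ℝ, E) E))
      (extChartAt 𝓘(ℝ, E) x₀ ((extChartAt 𝓘(ℝ, E) x₀).symm y)) :=
    contMDiffAt_vectorSpace_iff_contDiffAt.2 contDiffAt_const
  have h2 := ContMDiffAt.mpullback_vectorField_preimage hc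
    (contMDiffAt_extChartAt' (n := ∞) (by simpa using hs y hy))
    (isInvertible_mfderiv_extChartAt (hs y hy)) (by simp)
  have h3 := ContMDiffAt.comp y h2 (contMDiffAt_chart_symm hy)
  refine h3.congr_of_eventuallyEq (Filter.eventuallyEq_of_mem
    ((isOpen_extChartAt_target x₀).mem_nhds hy) fun z hz => ?_)
  have hinv : chartSymmDeriv x₀ z u =
      (chartDeriv x₀ ((extChartAt 𝓘(ℝ, E) x₀).symm z)).inverse u := by
    conv_rhs => rw [← chartDeriv_chartSymmDeriv hz u]
    exact (inverse_apply_apply (isInvertible_mfderiv_extChartAt (hs z hz)) _).symm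
  simp only [Function.comp_apply, hinv]
  rfl

theorem isMetricOn_tensorInChart (g : SemiRiemannianMetric E M) (x₀ : M) {U : Set M}
    (hU : IsOpen U) : IsMetricOn (tensorInChart g.val x₀) (chartDomain x₀ U) where
  isOpen := isOpen_chartDomain x₀ hU
  contDiffOn := by
    refine contDiffOn_clm_apply.2 fun u => contDiffOn_clm_apply.2 fun v => fun y hy => ?_
    have hg := (g.contMDiff.contMDiffAt (x := (extChartAt 𝓘(ℝ, E) x₀).symm y)).comp y
      (contMDiffAt_chart_symm hy.1)
    have h : ContMDiffAt 𝓘(ℝ, E) (𝓘(ℝ, E).prod 𝓘(ℝ)) ∞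
        (fun z : E => Bundle.TotalSpace.mk' ℝ (E := Bundle.Trivial M ℝ)
          ((extChartAt 𝓘(ℝ, E) x₀).symm z) (g.val ((extChartAt 𝓘(ℝ, E) x₀).symm z)
            (chartSymmDeriv x₀ z u) (chartSymmDeriv x₀ z v))) y := by
      apply ContMDiffAt.clm_bundle_apply₂ (F₁ := E) (F₂ := E)
      · exact hg
      · exact contMDiffAt_chartSymmDeriv hy.1 u
      · exact contMDiffAt_chartSymmDeriv hy.1 v
    rw [Bundle.contMDiffAt_totalSpace] at h
    exact (contMDiffAt_iff_contDiffAt.1 h.2).contDiffWithinAt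
  symm y _ v w := g.symm _ _ _
  nondegenerate y hy v hv := by
    have h : chartSymmDeriv x₀ y v = 0 := g.nondegenerate _ _ fun w => by
      have e := chartSymmDeriv_chartDeriv hy.1 w
      exact (congrArg (fun w : E => g.val ((extChartAt 𝓘(ℝ, E) x₀).symm y)
        (chartSymmDeriv x₀ y v) w) e).symm.trans (hv _)
    rw [← chartDeriv_chartSymmDeriv hy.1 v, h, map_zero]

theorem tensorInChart_ricci (g : SemiRiemannianMetric E M) (x₀ : M) :
    EqOn (tensorInChart (ricci g.val) x₀) (ricciCoord (tensorInChart g.val x₀))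
      (extChartAt 𝓘(ℝ, E) x₀).target := by
  intro y hy
  set p := (extChartAt 𝓘(ℝ, E) x₀).symm y with hp
  have hyO := mem_chartDomain_source_self hy
  ext u v
  have key := (isMetricOn_tensorInChart g p isOpen_univ).ricciCoord_pullback
    (isMetricOn_tensorInChart g x₀ (isOpen_extChartAt_source (I := 𝓘(ℝ, E)) p))
    (contDiffOn_transition x₀ p) (fun z hz => transition_mem hz (mem_univ _))
    (fun z hz u v => tensorInChart_transition g.val hz u v) hyO u v
  rw [key, fderiv_transition hyO, fderiv_transition hyO]
  rfl

theorem tensorInChart_iterate_lieDeriv {X : ∀ x : M, TangentSpace 𝓘(ℝ, E) x}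
    {T : TwoTensorField E M} {U : Set M} (hU : IsOpen U)
    (hX : ∀ x₀ : M, ContDiffOn ℝ ∞ (vectorInChart X x₀) (chartDomain x₀ U))
    (hT : IsSmoothInCharts T U) (k : ℕ) : ∀ x₀ : M,
    EqOn (tensorInChart ((lieDeriv X)^[k] T) x₀)
      ((lieDerivCoord (vectorInChart X x₀))^[k] (tensorInChart T x₀)) (chartDomain x₀ U) := by
  induction k with
  | zero => exact fun _ _ _ => rfl
  | succ k ih =>
    intro x₀ y hy
    have hs : IsSmoothInCharts ((lieDeriv X)^[k] T) U := fun x₁ =>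
      (contDiffOn_iterate_lieDerivCoord (isOpen_chartDomain x₁ hU) (hX x₁) (hT x₁) k).congr (ih x₁)
    rw [Function.iterate_succ_apply', Function.iterate_succ_apply',
      tensorInChart_lieDeriv hU hX hs x₀ hy, lieDerivCoord_eq_derivAlong]
    exact eqOn_derivAlong (isOpen_chartDomain x₀ hU)
      (by rw [← lieDerivCoord_eq_derivAlong]; exact ih x₀) hy

omit [FiniteDimensional ℝ E] in
theorem chartSymmDeriv_self (x₀ : M) (u : E) :
    chartSymmDeriv x₀ (extChartAt 𝓘(ℝ, E) x₀ x₀) u = u := by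
  have := mfderivWithin_range_extChartAt_symm (I := 𝓘(ℝ, E)) (x := x₀)
  simp only [modelWithCornersSelf_coe, range_id, mfderivWithin_univ] at this
  exact congrArg (fun A : E →L[ℝ] E => A u) this

omit [FiniteDimensional ℝ E] in
/-- The coordinate expression of a tensor field in the preferred chart at `x₀` agrees at `x₀` with
the tensor itself, since tangent vectors at `x₀` are identified with `E` by that chart. -/
theorem tensorInChart_self (T : TwoTensorField E M) (x₀ : M) (u v : E) :
    tensorInChart T x₀ (extChartAt 𝓘(ℝ, E) x₀ x₀) u v = T x₀ u v := by
  rw [tensorInChart_eq, chartSymmDeriv_self, chartSymmDeriv_self]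
  exact congrArg (fun x => (T x : E →L[ℝ] E →L[ℝ] ℝ) u v) (extChartAt_to_inv x₀)

omit [FiniteDimensional ℝ E] in
theorem vectorInChart_self (X : ∀ x : M, TangentSpace 𝓘(ℝ, E) x) (x₀ : M) :
    vectorInChart X x₀ (extChartAt 𝓘(ℝ, E) x₀ x₀) = X x₀ := by
  rw [← chartSymmDeriv_self x₀ (vectorInChart X x₀ (extChartAt 𝓘(ℝ, E) x₀ x₀)),
    chartSymmDeriv_vectorInChart X (mem_extChartAt_target x₀)]
  exact congrArg (fun x => (X x : E)) (extChartAt_to_inv x₀)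

end Smoothness

/-! ### Immersions -/

section Immersion

variable {E : Type*} [NormedAddCommGroup E] [NormedSpace ℝ E]
  {M : Type*} [TopologicalSpace M] [ChartedSpace E M]
  {F : Type*} [NormedAddCommGroup F] [NormedSpace ℝ F]
  {N : Type*} [TopologicalSpace N] [ChartedSpace F N]

/-- An immersion has injective derivative, because it has a differentiable local left inverse. -/
theorem injective_mfderiv_of_isImmersionAt {Φ : N → M} {p : N}
    (h : Manifold.IsImmersionAt 𝓘(ℝ, F) 𝓘(ℝ, E) ∞ Φ p) :
    Function.Injective (mfderiv 𝓘(ℝ, F) 𝓘(ℝ, E) Φ p) := by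
  have hΦp := h.source_subset_preimage_source h.mem_domChart_source
  have hwr : ∀ q ∈ h.domChart.source, h.codChart (Φ q) = h.equiv (h.domChart q, 0) := by
    intro q hq
    have hq' : h.domChart.extend 𝓘(ℝ, F) q ∈ (h.domChart.extend 𝓘(ℝ, F)).target :=
      (h.domChart.extend 𝓘(ℝ, F)).map_source (by rwa [OpenPartialHomeomorph.extend_source])
    have := h.writtenInCharts hq'
    simp only [Function.comp_apply] at this
    rw [OpenPartialHomeomorph.extend_left_inv _ hq] at this
    exact this
  have d1 : MDifferentiableAt 𝓘(ℝ, E) 𝓘(ℝ, E) h.codChart (Φ p) :=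
    (contMDiffAt_of_mem_maximalAtlas h.codChart_mem_maximalAtlas hΦp).mdifferentiableAt (by simp)
  let π : E →L[ℝ] F := (ContinuousLinearMap.fst ℝ F h.complement).comp
    (h.equiv.symm : E →L[ℝ] F × h.complement)
  have hπ : ∀ q ∈ h.domChart.source, π (h.codChart (Φ q)) = h.domChart q := fun q hq => by
    rw [hwr q hq]
    simp [π]
  have d2 : MDifferentiableAt 𝓘(ℝ, E) 𝓘(ℝ, F) π (h.codChart (Φ p)) :=
    π.differentiableAt.mdifferentiableAt
  have d3 : MDifferentiableAt 𝓘(ℝ, F) 𝓘(ℝ, F) h.domChart.symm (π (h.codChart (Φ p))) := by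
    refine (contMDiffAt_symm_of_mem_maximalAtlas h.domChart_mem_maximalAtlas ?_).mdifferentiableAt
      (by simp)
    rw [hπ p h.mem_domChart_source]
    exact h.domChart.map_source h.mem_domChart_source
  have d4 : MDifferentiableAt 𝓘(ℝ, F) 𝓘(ℝ, E) Φ p := h.contMDiffAt.mdifferentiableAt (by simp)
  have d5 : MDifferentiableAt 𝓘(ℝ, E) 𝓘(ℝ, F) (h.domChart.symm ∘ (π ∘ h.codChart)) (Φ p) :=
    d3.comp (Φ p) (d2.comp (Φ p) d1)
  have e : (h.domChart.symm ∘ (π ∘ h.codChart)) ∘ Φ =ᶠ[𝓝 p] id :=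
    Filter.eventuallyEq_of_mem (h.domChart.open_source.mem_nhds h.mem_domChart_source)
        fun q hq => by
      simp only [Function.comp_apply, id]
      rw [hπ q hq, h.domChart.left_inv hq]
  have hid := e.mfderiv_eq (I := 𝓘(ℝ, F)) (I' := 𝓘(ℝ, F))
  rw [mfderiv_id, mfderiv_comp p d5 d4] at hid
  intro u v huv
  have hu := congrArg (fun A : F →L[ℝ] F => A u) hid
  have hv := congrArg (fun A : F →L[ℝ] F => A v) hid
  refine hu.symm.trans (Eq.trans ?_ hv)
  exact congrArg (mfderiv 𝓘(ℝ, E) 𝓘(ℝ, F) (h.domChart.symm ∘ (π ∘ h.codChart)) (Φ p)) huv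

end Immersion

/-! ### Hypersurfaces in the preferred chart -/

section Hypersurface

variable {E : Type*} [NormedAddCommGroup E] [NormedSpace ℝ E]
  {M : Type*} [TopologicalSpace M] [ChartedSpace E M] [IsManifold 𝓘(ℝ, E) ∞ M]
  {F : Type*} [NormedAddCommGroup F] [NormedSpace ℝ F]
  {N : Type*} [TopologicalSpace N] [ChartedSpace F N]
  {W : Type*} [NormedAddCommGroup W] [NormedSpace ℝ W]

/-- A function in the preferred chart at `Φ p` that vanishes on the image of `Φ` has vanishing
derivative in the directions tangent to `Φ`. -/
theorem fderiv_apply_mfderiv_eq_zero {Φ : N → M} {p : N}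
    (hΦ : MDifferentiableAt 𝓘(ℝ, F) 𝓘(ℝ, E) Φ p) {f : E → W}
    (hf : DifferentiableAt ℝ f (extChartAt 𝓘(ℝ, E) (Φ p) (Φ p)))
    (h0 : ∀ z ∈ chartDomain (Φ p) (range Φ), f z = 0) (w : F) :
    fderiv ℝ f (extChartAt 𝓘(ℝ, E) (Φ p) (Φ p)) (mfderiv 𝓘(ℝ, F) 𝓘(ℝ, E) Φ p w) = 0 := by
  have d1 : MDifferentiableAt 𝓘(ℝ, E) 𝓘(ℝ, E) (extChartAt 𝓘(ℝ, E) (Φ p)) (Φ p) :=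
    mdifferentiableAt_extChartAt (mem_chart_source E (Φ p))
  have d2 : MDifferentiableAt 𝓘(ℝ, E) 𝓘(ℝ, W) f (extChartAt 𝓘(ℝ, E) (Φ p) (Φ p)) :=
    hf.mdifferentiableAt
  have d3 : MDifferentiableAt 𝓘(ℝ, E) 𝓘(ℝ, W) (f ∘ extChartAt 𝓘(ℝ, E) (Φ p)) (Φ p) :=
    d2.comp (Φ p) d1
  have e : (f ∘ extChartAt 𝓘(ℝ, E) (Φ p)) ∘ Φ =ᶠ[𝓝 p] fun _ => 0 := by
    filter_upwards [hΦ.continuousAt.preimage_mem_nhds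
      (extChartAt_source_mem_nhds (I := 𝓘(ℝ, E)) (Φ p))] with q hq
    refine h0 _ ⟨(extChartAt 𝓘(ℝ, E) (Φ p)).map_source hq, q, ?_⟩
    exact ((extChartAt 𝓘(ℝ, E) (Φ p)).left_inv hq).symm
  have hz := e.mfderiv_eq (I := 𝓘(ℝ, F)) (I' := 𝓘(ℝ, W))
  rw [mfderiv_const, mfderiv_comp p d3 hΦ, mfderiv_comp (Φ p) d2 d1, mfderiv_extChartAt_self,
    mfderiv_eq_fderiv] at hz
  exact congrArg (fun A : F →L[ℝ] W => A w) hz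

/-- At each point, the restriction to the hypersurface of the `m`-th Lie derivative of
`Ric - λ g` is annihilated by `n` and has vanishing `P`-trace. -/
theorem nField_and_trP_iterate_lieDeriv [FiniteDimensional ℝ E] [FiniteDimensional ℝ F]
    (hdim : Module.finrank ℝ E = Module.finrank ℝ F + 1) (g : SemiRiemannianMetric E M)
    {Φ : N → M} (hΦ : Manifold.IsImmersion 𝓘(ℝ, F) 𝓘(ℝ, E) ∞ Φ)
    (hnull : IsNull (F := F) Φ g.val) {U : Set M} {ξ : ∀ x : M, TangentSpace 𝓘(ℝ, E) x}
    (hξ : IsRigging (F := F) Φ U ξ) (lam : ℝ) {m : ℕ} (hm : 1 ≤ m)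
    (hRic : ∀ i < m, ∀ p : N, (lieDeriv ξ)^[i] (ricci g.val) (Φ p) =
      lam • (lieDeriv ξ)^[i] g.val (Φ p)) (p : N) {B B' : F →L[ℝ] F →L[ℝ] ℝ}
    (hB : B = pullback (F := F) Φ ((lieDeriv ξ)^[m] (ricci g.val)) p)
    (hB' : B' = pullback (F := F) Φ ((lieDeriv ξ)^[m] g.val) p) :
    (∀ w : F, (B - lam • B') (nField F Φ g.val ξ p) w = 0) ∧
      trP (V := F) (pullback (F := F) Φ g.val p) (ellForm Φ g.val ξ p) (ellTwo Φ g.val ξ p)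
        (B - lam • B') = 0 := by
  set x₀ : M := Φ p with hx₀
  set y₀ : E := extChartAt 𝓘(ℝ, E) x₀ x₀ with hy₀
  set Ω : Set E := chartDomain x₀ U with hΩ
  set G := tensorInChart g.val x₀ with hGdef
  set X := vectorInChart ξ x₀ with hXdef
  set ι : F →L[ℝ] E := mfderiv 𝓘(ℝ, F) 𝓘(ℝ, E) Φ p with hι
  have hG : IsMetricOn G Ω := isMetricOn_tensorInChart g x₀ hξ.isOpen
  have hX : ∀ x₁ : M, ContDiffOn ℝ ∞ (vectorInChart ξ x₁) (chartDomain x₁ U) :=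
    contDiffOn_vectorInChart hξ.isOpen hξ.contMDiffOn
  have hHΩ : chartDomain x₀ (range Φ) ⊆ Ω := fun z hz => ⟨hz.1, hξ.range_subset hz.2⟩
  have hy₀H : y₀ ∈ chartDomain (E := E) x₀ (range Φ) :=
    ⟨mem_extChartAt_target x₀, p, (extChartAt_to_inv x₀).symm⟩
  have hgs : IsSmoothInCharts g.val U := fun x₁ =>
    (isMetricOn_tensorInChart g x₁ hξ.isOpen).contDiffOn
  have hRs : IsSmoothInCharts (ricci g.val) U := fun x₁ =>
    (isMetricOn_tensorInChart g x₁ hξ.isOpen).contDiffOn_ricciCoord.congr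
      fun y hy => tensorInChart_ricci g x₁ hy.1
  have hgi : ∀ k, ∀ z ∈ Ω, tensorInChart ((lieDeriv ξ)^[k] g.val) x₀ z =
      (lieDerivCoord X)^[k] G z := fun k z hz =>
    tensorInChart_iterate_lieDeriv hξ.isOpen hX hgs k x₀ hz
  have hRi : ∀ k, ∀ z ∈ Ω, tensorInChart ((lieDeriv ξ)^[k] (ricci g.val)) x₀ z =
      (lieDerivCoord X)^[k] (ricciCoord G) z := fun k z hz => by
    rw [tensorInChart_iterate_lieDeriv hξ.isOpen hX hRs k x₀ hz, lieDerivCoord_eq_derivAlong]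
    exact eqOn_iterate_derivAlong hG.isOpen (fun y hy => tensorInChart_ricci g x₀ hy.1) k hz
  have hιinj : Function.Injective ι :=
    injective_mfderiv_of_isImmersionAt (hΦ.isImmersionAt p)
  have hΦd : MDifferentiableAt 𝓘(ℝ, F) 𝓘(ℝ, E) Φ p := by
    exact (hΦ.isImmersionAt p).contMDiffAt.mdifferentiableAt (by simp)
  have hXy : X y₀ = ξ x₀ := vectorInChart_self ξ x₀
  have hXι : X y₀ ∉ range ι := by
    rw [hXy]; exact hξ.transversal p
  -- the conormal of the hypersurface, normalized by the rigging
  obtain ⟨J, hJ⟩ := exists_rigging_equiv hdim hιinj hXι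
  set α : E →L[ℝ] ℝ := LinearMap.toContinuousLinearMap
    (LinearMap.snd ℝ F ℝ ∘ₗ J.symm.toLinearMap) with hα
  have hαJ : ∀ q, α (J q) = q.2 := fun q => by simp [hα]
  have hαι : ∀ v, α (ι v) = 0 := fun v => by
    have := hαJ (v, 0)
    rwa [hJ, zero_smul, add_zero] at this
  have hαX : α (X y₀) = 1 := by
    have := hαJ (0, 1)
    rwa [hJ, map_zero, zero_add, one_smul] at this
  have hH : ∀ f : E → E →L[ℝ] E →L[ℝ] ℝ, DifferentiableAt ℝ f y₀ →
      (∀ z ∈ chartDomain x₀ (range Φ), f z = 0) →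
        fderiv ℝ f y₀ = α.smulRight (fderiv ℝ f y₀ (X y₀)) := by
    intro f hf h0
    refine ContinuousLinearMap.ext fun e => ?_
    obtain ⟨q, rfl⟩ := J.surjective e
    have h1 := fderiv_apply_mfderiv_eq_zero hΦd hf h0 q.1
    rw [ContinuousLinearMap.smulRight_apply, hαJ, hJ, map_add, map_smul]
    exact (congrArg (· + _) h1).trans (zero_add _)
  have hRic' : ∀ i < m, ∀ z ∈ chartDomain x₀ (range Φ),
      (lieDerivCoord X)^[i] (ricciCoord G) z = lam • (lieDerivCoord X)^[i] G z := by
    rintro i hi z ⟨hz, q, hq⟩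
    have hzΩ : z ∈ Ω := hHΩ ⟨hz, q, hq⟩
    rw [← hRi i z hzΩ, ← hgi i z hzΩ]
    have h1 := hRic i hi q
    rw [hq] at h1
    ext u v
    rw [tensorInChart_eq, h1]
    rfl
  set S : E →L[ℝ] E →L[ℝ] ℝ := (lieDerivCoord X)^[m] (ricciCoord G) y₀ -
    lam • (lieDerivCoord X)^[m] G y₀ with hSdef
  have hy₀Ω := hHΩ hy₀H
  have hXΩ : ContDiffOn ℝ ∞ X Ω := hX x₀
  have hSs : ∀ v w, S v w = S w v := fun v w => by
    have h1 := iterate_lieDerivCoord_symm hG.isOpen hXΩ hG.contDiffOn_ricciCoord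
      (fun y hy => hG.ricciCoord_symm hy) m y₀ hy₀Ω v w
    have h2 := iterate_lieDerivCoord_symm hG.isOpen hXΩ hG.contDiffOn hG.symm m y₀ hy₀Ω v w
    simp only [hSdef, sub_apply, smul_apply, h1, h2]
  have hS : ∀ v, 2 * ∑ j, α (frame E j) * S v (dualFrame (G y₀) j) =
      α v * ∑ j, S (frame E j) (dualFrame (G y₀) j) := fun v => by
    have := hG.bianchiSymbol_iterate_lieDerivCoord hXΩ hHΩ hy₀H hH lam hm hRic' v
    rw [← hSdef] at this
    simp only [bianchiSymbol, FunLike.coe_sum, Finset.sum_apply, sub_apply, smul_apply,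
      evalThree_apply, ContinuousLinearMap.smulRight_apply, smul_eq_mul,
      Finset.sum_sub_distrib, ← Finset.mul_sum] at this
    exact sub_eq_zero.1 this
  have hG₀ : ∀ u v : E, G y₀ u v = g.val x₀ u v := tensorInChart_self g.val x₀
  refine nVec_and_trP_eq_zero hdim hιinj hXι (hG.nondegenerate y₀ hy₀Ω) (hG.symm y₀ hy₀Ω)
    (fun u v => (hG₀ _ _).symm) (fun v => ?_) ?_ (hnull p) hαι hαX hSs hS fun u v => ?_
  · exact ((hG₀ _ _).trans (congrArg (fun e : E => g.val x₀ e (ι v)) hXy)).symm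
  · exact ((hG₀ _ _).trans (congrArg (fun e : E => g.val x₀ e e) hXy)).symm
  · rw [hB, hB', hSdef, ← hRi m y₀ hy₀Ω, ← hgi m y₀ hy₀Ω]
    exact (congrArg₂ (fun a b : ℝ => a - lam * b)
      (tensorInChart_self ((lieDeriv ξ)^[m] (ricci g.val)) x₀ (ι u) (ι v))
      (tensorInChart_self ((lieDeriv ξ)^[m] g.val) x₀ (ι u) (ι v))).symm

end Hypersurface

end NullHypersurface

end

theorem mainTheorem5
    {E : Type*} [NormedAddCommGroup E] [NormedSpace ℝ E] [FiniteDimensional ℝ E]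
    {M : Type*} [TopologicalSpace M] [ChartedSpace E M] [IsManifold 𝓘(ℝ, E) ∞ M]
    {F : Type*} [NormedAddCommGroup F] [NormedSpace ℝ F] [FiniteDimensional ℝ F]
    {N : Type*} [TopologicalSpace N] [ChartedSpace F N] [IsManifold 𝓘(ℝ, F) ∞ N]
    (hdim : Module.finrank ℝ E = Module.finrank ℝ F + 1)
    (g : NullHypersurface.SemiRiemannianMetric E M)
    (Φ : N → M) (hΦ : Manifold.IsSmoothEmbedding 𝓘(ℝ, F) 𝓘(ℝ, E) ∞ Φ)
    (hnull : NullHypersurface.IsNull (F := F) Φ g.val)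
    (U : Set M) (ξ : ∀ x : M, TangentSpace 𝓘(ℝ, E) x)
    (hξ : NullHypersurface.IsRigging (F := F) Φ U ξ)
    (lam : ℝ) (m : ℕ) (hm : 1 ≤ m)
    (hRic : ∀ i ∈ Finset.Icc 1 m, ∀ p : N,
      (NullHypersurface.lieDeriv ξ)^[i - 1] (NullHypersurface.ricci g.val) (Φ p) =
        lam • (NullHypersurface.lieDeriv ξ)^[i - 1] g.val (Φ p)) :
    (∀ (p : N) (v : TangentSpace 𝓘(ℝ, F) p),
      NullHypersurface.pullback Φ
          ((NullHypersurface.lieDeriv ξ)^[m] (NullHypersurface.ricci g.val)) p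
          (NullHypersurface.nField F Φ g.val ξ p) v =
        lam * NullHypersurface.pullback Φ ((NullHypersurface.lieDeriv ξ)^[m] g.val) p
          (NullHypersurface.nField F Φ g.val ξ p) v) ∧
    (∀ p : N,
      NullHypersurface.traceP (F := F) Φ g.val ξ
          (NullHypersurface.pullback Φ
            ((NullHypersurface.lieDeriv ξ)^[m] (NullHypersurface.ricci g.val))) p =
        lam * NullHypersurface.traceP (F := F) Φ g.val ξ
          (NullHypersurface.pullback Φ ((NullHypersurface.lieDeriv ξ)^[m] g.val)) p) := by
  have h : ∀ p : N, _ := fun p =>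
    NullHypersurface.nField_and_trP_iterate_lieDeriv hdim g hΦ.isImmersion hnull hξ lam hm
      (fun i hi q => hRic (i + 1) (Finset.mem_Icc.2 ⟨by lia, by lia⟩) q) p rfl rfl
  refine ⟨fun p v => sub_eq_zero.1 ((h p).1 v), fun p => sub_eq_zero.1 ?_⟩
  exact (NullHypersurface.trP_sub_smul (F := F) _ _ _ _ _ lam).symm.trans (h p).2
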